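/- Fix $r\in(0,1)$ and let $\mathbb A_r=\{z\in\mathbb C: r<|z|<1\}$, $\mathbb D=\{z\in\mathbb C:|z|<1\}$. For every $x\in(r,1)$ there is a unique injective holomorphic map $f_x:\mathbb A_r\to\mathbb D$ such that $f_x(x)=0$, the unit circle corresponds to itself under $f_x$ (i.e. all limit points of $f_x(z)$ as $z\in\mathbb A_r$ tends to a point of $\partial\mathbb D$ lie on $\partial\mathbb D$), and $\Gamma_x:=\mathbb D\setminus f_x(\mathbb A_r)$ is a (closed, non-degenerate, proper) arc of a circle centred at the origin, symmetric with respect to the real axis and intersecting the interval $(-1,0)$. These maps have the following properties. (A) For each $x\in(r,1)$ the map $f_x$ has a holomorphic extension to $\mathbb A_{r,x}:=\{z\in\mathbb C: r^2/x<|z|<1/x\}$, and, with this extension again denoted by $f_x$, the function $(x,z)\mapsto f_x(z)$ is of class $C^\infty$ on $\{(x,z): x\in(r,1),\ z\in\mathbb A_{r,x}\}$. (B) For each $x\in(r,1)$ we have $f_\alpha(x)=-f_x(\alpha)$ for all $\alpha\in(r,1)$; moreover $f_x'(x)$ is real and $$\frac{d}{d\alpha}\Big|_{\alpha=x} f_\alpha(x)=-f_x'(x)<-\frac1{1-x^2}.$$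 (C) For each $x\in(r,1)$ the arc $\Gamma_x$ intersects the real line exactly at the point $-x$. (D) For each $x\in(r,1)$ exactly one endpoint $\Gamma_x^+$ of the arc $\Gamma_x$ lies in the open upper half-plane, and $x\mapsto\Gamma_x^+$ is a $C^\infty$ function on $(r,1)$. -/

import Mathlib

open scoped ContDiff

/-- The open annulus `{z : a < |z| < b}` centred at the origin. -/
def annulus (a b : ℝ) : Set ℂ := {z | a < ‖z‖ ∧ ‖z‖ < b}

/-- The set `{ρ e^{iθ} : a ≤ θ ≤ b}`. -/
noncomputable def circularArc (ρ a b : ℝ) : Set ℂ :=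
  (fun θ : ℝ => (ρ : ℂ) * Complex.exp ((θ : ℂ) * Complex.I)) '' Set.Icc a b

/-- `Γ` is a closed circular arc centred at the origin: neither a point nor a full circle. -/
def IsCircularArc (Γ : Set ℂ) : Prop :=
  ∃ ρ a b : ℝ, 0 < ρ ∧ a < b ∧ b < a + 2 * Real.pi ∧ Γ = circularArc ρ a b

/-- `e` is one of the two endpoints of the circular arc `Γ` centred at the origin. -/
def IsArcEndpoint (Γ : Set ℂ) (e : ℂ) : Prop :=
  ∃ ρ a b : ℝ, 0 < ρ ∧ a < b ∧ b < a + 2 * Real.pi ∧ Γ = circularArc ρ a b ∧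
    (e = (ρ : ℂ) * Complex.exp ((a : ℂ) * Complex.I) ∨
      e = (ρ : ℂ) * Complex.exp ((b : ℂ) * Complex.I))

/-- The complement in the unit disk of the image of `{r < |z| < 1}` under `f`. -/
def slit (r : ℝ) (f : ℂ → ℂ) : Set ℂ := Metric.ball 0 1 \ f '' annulus r 1

/-- `f` (only its values on `{r < |z| < 1}` matter) is a conformal map of this annulus into the
unit disk with `f x = 0`, under which the unit circle corresponds to the unit circle, and such
that the omitted set `slit r f` is a circular arc centred at the origin, symmetric with respect
to the real axis and meeting the interval `(-1, 0)`. -/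
structure IsCanonicalMap (r x : ℝ) (f : ℂ → ℂ) : Prop where
  holo : DifferentiableOn ℂ f (annulus r 1)
  inj : Set.InjOn f (annulus r 1)
  mapsTo : Set.MapsTo f (annulus r 1) (Metric.ball 0 1)
  map_zero : f (x : ℂ) = 0
  /-- All limit points of `f` at points of the unit circle lie on the unit circle. -/
  circle_to_circle : ∀ ζ ∈ Metric.sphere (0 : ℂ) 1, ∀ w : ℂ,
    MapClusterPt w (nhdsWithin ζ (annulus r 1)) f → w ∈ Metric.sphere (0 : ℂ) 1
  arc : IsCircularArc (slit r f)
  symm : ∀ w ∈ slit r f, (starRingEnd ℂ) w ∈ slit r f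
  meets : ∃ t : ℝ, -1 < t ∧ t < 0 ∧ (t : ℂ) ∈ slit r f

/-! Reflecting in the two boundary circles writes the canonical map as `(z - x)` times a quotient of
theta functions with nome `q = r²`. The reflection identities `f(1/z) f(z) = 1` and
`f(r²/z) f(z) = x²` give `|f| = 1` on the unit circle and `|f| = x` on the inner circle, and the
interlacing of the real zeros and poles gives `0 < im f` on the upper half-plane. On the boundary of
the upper half of the annulus the imaginary part of `d log f / d log z` has upper limits at most
`0`, hence it is negative inside, so that `log ∘ f ∘ exp` is injective there; by symmetry under
conjugation `f` is injective and its slit is the image of the inner circle, an arc of radius `x`.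

The product formula is antisymmetric in `x` and `z`, which gives (B), the derivative being bounded
factor by factor with `(1 - a y) (1 - a / y) ≤ (1 - a)²`. The quotient of two canonical maps has
modulus `|z| ^ κ` and a single-valued logarithm near the inner circle, so `κ = 0` and the quotient
is constant; the symmetry of the slits makes it `1`. The upper endpoint of the slit is
`f(r exp(iθ))`, where `θ` is the zero of `re (d log f / d log z)` on the upper half of the inner
circle; by Hopf's lemma this zero is simple, and the implicit function theorem makes it smooth in
`x`. -/

open Complex Set Filter Topology Metric
open scoped ComplexConjugate Real

/-! ### Holomorphic functions and their boundary behaviour -/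

theorem injOn_of_deriv_im_neg {f f' : ℂ → ℂ} {s : Set ℂ} (hs : Convex ℝ s)
    (hf : ∀ w ∈ s, HasDerivAt f (f' w) w) (hf' : ∀ w ∈ s, (f' w).im < 0) : InjOn f s := by
  intro a ha b hb hab
  by_contra hne
  have hba : b - a ≠ 0 := sub_ne_zero.2 (Ne.symm hne)
  have hmem : ∀ t ∈ Icc (0 : ℝ) 1, a + t * (b - a) ∈ s := fun t ht => by
    simpa using hs.add_smul_sub_mem ha hb ht
  have hd : ∀ t ∈ Icc (0 : ℝ) 1, HasDerivAt (fun t : ℝ => (f (a + t * (b - a)) / (b - a)).im)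
      (f' (a + t * (b - a))).im t := by
    intro t ht
    have hline : HasDerivAt (fun t : ℝ => a + (t : ℂ) * (b - a)) (b - a) t := by
      simpa using ((hasDerivAt_id t).ofReal_comp.mul_const (b - a)).const_add a
    have hcomp := ((hf _ (hmem t ht)).comp t hline).div_const (b - a)
    rw [mul_div_cancel_right₀ _ hba] at hcomp
    exact imCLM.hasFDerivAt.comp_hasDerivAt t hcomp
  obtain ⟨c, hc, hzero⟩ := exists_hasDerivAt_eq_zero (zero_lt_one' ℝ)
    (fun t ht => (hd t ht).continuousAt.continuousWithinAt) (by simp [hab])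
    (fun t ht => hd t (Ioo_subset_Icc_self ht))
  exact (hf' _ (hmem c (Ioo_subset_Icc_self hc))).ne hzero

/-- A real function that is locally the modulus of a holomorphic function; the modulus of a
multivalued holomorphic function is of this kind. -/
def IsLocallyHolomorphicNormOn (u : ℂ → ℝ) (U : Set ℂ) : Prop :=
  ∀ z ∈ U, ∃ g : ℂ → ℂ, (∀ᶠ w in 𝓝 z, DifferentiableAt ℂ g w) ∧ ∀ᶠ w in 𝓝 z, u w = ‖g w‖

namespace IsLocallyHolomorphicNormOn

variable {u : ℂ → ℝ} {U : Set ℂ}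

theorem continuousAt (hu : IsLocallyHolomorphicNormOn u U) {z : ℂ} (hz : z ∈ U) :
    ContinuousAt u z := by
  obtain ⟨g, hg, hug⟩ := hu z hz
  exact hg.self_of_nhds.continuousAt.norm.congr (hug.mono fun w hw => hw.symm)

theorem eventually_eq_of_isMaxOn (hu : IsLocallyHolomorphicNormOn u U) (hU : IsOpen U) {p : ℂ}
    (hp : p ∈ U) (hmax : IsMaxOn u U p) : ∀ᶠ w in 𝓝 p, u w = u p := by
  obtain ⟨g, hg, hug⟩ := hu p hp
  have hloc : IsLocalMax (norm ∘ g) p := by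
    filter_upwards [hug, hU.mem_nhds hp] with w hw hwU
    rw [Function.comp_apply, Function.comp_apply, ← hw, ← hug.self_of_nhds]
    exact hmax hwU
  filter_upwards [hug, Complex.norm_eventually_eq_of_isLocalMax hg hloc] with w h₁ h₂
  rw [h₁, h₂, hug.self_of_nhds]

theorem isCompact_superlevel (hu : IsLocallyHolomorphicNormOn u U) (hb : Bornology.IsBounded U)
    {C c : ℝ} (hc : C < c)
    (hC : ∀ ζ ∈ frontier U, ∀ c' > C, ∀ᶠ w in 𝓝[U] ζ, u w < c') :
    IsCompact {z ∈ U | c ≤ u z} := by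
  refine isCompact_of_isClosed_isBounded (isClosed_of_closure_subset fun ζ hζ => ?_)
    (hb.subset (sep_subset _ _))
  have hfreq : ∃ᶠ w in 𝓝[U] ζ, c ≤ u w :=
    frequently_nhdsWithin_iff.2 ((mem_closure_iff_frequently.1 hζ).mono fun _ h => h.symm)
  have hζU : ζ ∈ U := by
    by_contra hζU
    have hfr : ζ ∈ frontier U :=
      ⟨closure_mono (sep_subset _ _) hζ, fun h => hζU (interior_subset h)⟩
    exact hfreq ((hC ζ hfr c hc).mono fun w hw => hw.not_ge)
  have hlim := ((hu.continuousAt hζU).tendsto.mono_left nhdsWithin_le_nhds : Tendsto u (𝓝[U] ζ) _)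
  exact ⟨hζU, ge_of_tendsto_of_frequently hlim hfreq⟩

theorem le_of_frontier (hu : IsLocallyHolomorphicNormOn u U) (hU : IsOpen U)
    (hb : Bornology.IsBounded U) {C : ℝ}
    (hC : ∀ ζ ∈ frontier U, ∀ c' > C, ∀ᶠ w in 𝓝[U] ζ, u w < c') {z : ℂ} (hz : z ∈ U) :
    u z ≤ C := by
  by_contra! hlt
  have hcont : ContinuousOn u U := fun w hw => (hu.continuousAt hw).continuousWithinAt
  have hK := hu.isCompact_superlevel hb hlt hC
  obtain ⟨p, ⟨hpU, hzp⟩, hpmax⟩ := hK.exists_isMaxOn ⟨z, hz, le_rfl⟩ (hcont.mono (sep_subset _ _))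
  have hmax : IsMaxOn u U p := fun w hw =>
    (le_total (u z) (u w)).elim (fun h => hpmax ⟨hw, h⟩) fun h => h.trans hzp
  have hMK : IsCompact {w ∈ U | u p ≤ u w} := hu.isCompact_superlevel hb (hlt.trans_le hzp) hC
  have hMo : IsOpen {w ∈ U | u p ≤ u w} := isOpen_iff_mem_nhds.2 fun w hw => by
    have hwmax : IsMaxOn u U w := fun v hv => (hmax hv).trans hw.2
    filter_upwards [hU.mem_nhds hw.1, hu.eventually_eq_of_isMaxOn hU hw.1 hwmax] with v hv h
    exact ⟨hv, hw.2.trans h.ge⟩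
  have huniv := IsClopen.eq_univ ⟨hMK.isClosed, hMo⟩ ⟨p, hpU, le_rfl⟩
  exact noncompact_univ ℂ (huniv ▸ hMK)

end IsLocallyHolomorphicNormOn

theorem exists_re_nonneg_pow_eq {n : ℕ} (hn : 2 ≤ n) (w : ℂ) : ∃ d : ℂ, 0 ≤ d.re ∧ d ^ n = w := by
  refine ⟨w ^ (n : ℂ)⁻¹, ?_, cpow_nat_inv_pow w (by omega)⟩
  have hn' : (2 : ℝ) ≤ n := by exact_mod_cast hn
  have harg : |arg w * (n : ℝ)⁻¹| ≤ π / 2 := by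
    rw [abs_mul, abs_of_nonneg (by positivity : 0 ≤ (n : ℝ)⁻¹), div_eq_mul_inv]
    gcongr
    exact abs_arg_le_pi w
  have := cpow_ofReal_re w (n : ℝ)⁻¹
  push_cast at this
  rw [this]
  have hcos := Real.cos_nonneg_of_neg_pi_div_two_le_of_le (abs_le.1 harg).1 (abs_le.1 harg).2
  positivity

theorem eq_one_and_im_neg_of_forall_re_nonneg {n : ℕ} {k : ℂ} (hn : n ≠ 0) (hk : k ≠ 0)
    (h : ∀ d : ℂ, 0 ≤ d.re → (d ^ n * k).im ≤ 0) : n = 1 ∧ k.im < 0 := by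
  have hn1 : n = 1 := by
    by_contra hn1
    obtain ⟨d, hd, hdn⟩ := exists_re_nonneg_pow_eq (by omega : 2 ≤ n) (I * conj k)
    have hpos : 0 < normSq k := normSq_pos.2 hk
    have hle := h d hd
    rw [hdn, mul_assoc, ← normSq_eq_conj_mul_self] at hle
    simp only [I_mul_im, ofReal_re] at hle
    exact hle.not_gt hpos
  subst hn1
  have h₁ := h 1 (by simp)
  have h₂ := h I (by simp)
  have h₃ := h (-I) (by simp)
  simp only [pow_one, one_mul, I_mul_im, neg_mul, neg_im, Left.neg_nonpos_iff] at h₁ h₂ h₃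
  exact ⟨rfl, lt_of_le_of_ne h₁ fun h₀ => hk (Complex.ext (le_antisymm h₂ h₃) h₀)⟩

theorem im_pow_mul_nonpos_of_im_nonpos {g k : ℂ → ℂ} {w₀ d : ℂ} {n : ℕ}
    (hk : ContinuousAt k w₀) (hg : ∀ᶠ w in 𝓝 w₀, g w = (w - w₀) ^ n * k w)
    (hd : ∀ᶠ t : ℝ in 𝓝[>] 0, (g (w₀ + t * d)).im ≤ 0) : (d ^ n * k w₀).im ≤ 0 := by
  have hray : Tendsto (fun t : ℝ => w₀ + t * d) (𝓝[>] 0) (𝓝 w₀) := by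
    have : Continuous fun t : ℝ => w₀ + t * d := by fun_prop
    simpa using (this.tendsto 0).mono_left nhdsWithin_le_nhds
  have hlim : Tendsto (fun t : ℝ => (d ^ n * k (w₀ + t * d)).im) (𝓝[>] 0)
      (𝓝 (d ^ n * k w₀).im) :=
    (continuous_im.tendsto _).comp ((hk.tendsto.comp hray).const_mul (d ^ n))
  refine le_of_tendsto hlim ?_
  filter_upwards [hray.eventually hg, hd, self_mem_nhdsWithin] with t hgt hle (ht : 0 < t)
  have hscale : (g (w₀ + t * d)).im = t ^ n * (d ^ n * k (w₀ + t * d)).im := by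
    rw [hgt, ← im_ofReal_mul, add_sub_cancel_left, mul_pow, ofReal_pow, mul_assoc]
  rw [hscale] at hle
  exact nonpos_of_mul_nonpos_right hle (pow_pos ht n)

theorem exists_eventually_sub_eq_pow_mul {g : ℂ → ℂ} {w₀ : ℂ} (hg : AnalyticAt ℂ g w₀)
    (hconst : ¬ ∀ᶠ w in 𝓝 w₀, g w = g w₀) :
    ∃ (n : ℕ) (k : ℂ → ℂ), n ≠ 0 ∧ AnalyticAt ℂ k w₀ ∧ k w₀ ≠ 0 ∧ (n = 1 → deriv g w₀ = k w₀) ∧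
      ∀ᶠ w in 𝓝 w₀, g w - g w₀ = (w - w₀) ^ n * k w := by
  obtain ⟨n, k, hk, hk₀, hgk⟩ :=
    (hg.sub (analyticAt_const (v := g w₀))).exists_eventuallyEq_pow_smul_nonzero_iff.2
      fun h => hconst (h.mono fun w hw => sub_eq_zero.1 hw)
  simp only [Pi.sub_apply, smul_eq_mul] at hgk
  refine ⟨n, k, ?_, hk, hk₀, ?_, hgk⟩
  · rintro rfl
    exact hk₀ (by simpa using hgk.self_of_nhds.symm)
  · rintro rfl
    have hderiv : HasDerivAt (fun w => (w - w₀) ^ 1 * k w + g w₀) (k w₀) w₀ := by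
      simpa using ((((hasDerivAt_id w₀).sub_const w₀).pow 1).mul
        hk.differentiableAt.hasDerivAt).add_const (g w₀)
    have heq : g =ᶠ[𝓝 w₀] fun w => (w - w₀) ^ 1 * k w + g w₀ :=
      hgk.mono fun w hw => sub_eq_iff_eq_add.1 hw
    exact (hderiv.congr_of_eventuallyEq heq).deriv

/- Hopf's boundary lemma. If `g` vanished to order `n ≥ 2` at `w₀`, its leading term would map the
right half-plane of directions onto all directions, contradicting the sign of `im g`. -/
theorem im_deriv_neg_of_im_neg_of_im_eq_zero {g : ℂ → ℂ} {w₀ : ℂ} (hg : AnalyticAt ℂ g w₀)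
    (hneg : ∀ᶠ w in 𝓝 w₀, w₀.re < w.re → (g w).im < 0)
    (hzero : ∀ᶠ w in 𝓝 w₀, w.re = w₀.re → (g w).im = 0) : (deriv g w₀).im < 0 := by
  have hg₀ : (g w₀).im = 0 := hzero.self_of_nhds rfl
  have hray (d : ℂ) : Tendsto (fun t : ℝ => w₀ + t * d) (𝓝[>] 0) (𝓝 w₀) := by
    have : Continuous fun t : ℝ => w₀ + t * d := by fun_prop
    simpa using (this.tendsto 0).mono_left nhdsWithin_le_nhds
  have hconst : ¬ ∀ᶠ w in 𝓝 w₀, g w = g w₀ := fun hconst => by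
    obtain ⟨t, ⟨h₁, h₂⟩, ht⟩ :=
      (((hray 1).eventually (hconst.and hneg)).and self_mem_nhdsWithin).exists
    exact (h₂ (by simpa using ht)).ne (by rw [h₁, hg₀])
  obtain ⟨n, k, hn, hk, hk₀, hderiv, hgk⟩ := exists_eventually_sub_eq_pow_mul hg hconst
  have hdir (d : ℂ) (hd : 0 ≤ d.re) : (d ^ n * k w₀).im ≤ 0 := by
    refine im_pow_mul_nonpos_of_im_nonpos hk.continuousAt hgk ?_
    filter_upwards [(hray d).eventually (hneg.and hzero), self_mem_nhdsWithin]
      with t ⟨h₁, h₂⟩ (ht : 0 < t)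
    have hre : (w₀ + t * d).re = w₀.re + t * d.re := by simp
    rw [sub_im, hg₀, sub_zero]
    rcases hd.eq_or_lt with h | h
    · exact (h₂ (by rw [hre, ← h, mul_zero, add_zero])).le
    · exact (h₁ (by rw [hre]; linarith [mul_pos ht h])).le
  obtain ⟨hn₁, him⟩ := eq_one_and_im_neg_of_forall_re_nonneg hn hk₀ hdir
  rwa [hderiv hn₁]

theorem exists_hasStrictDerivAt_pow_eq {k : ℂ → ℂ} {x : ℂ} {n : ℕ} (hn : n ≠ 0)
    (hk : AnalyticAt ℂ k x) (hk₀ : k x ≠ 0) :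
    ∃ ψ : ℂ → ℂ, ψ x = 0 ∧ HasStrictDerivAt ψ 1 x ∧
      ∀ z, (z - x) ^ n * k z = k x * ψ z ^ n := by
  have hroot : AnalyticAt ℂ (fun z => (k z / k x) ^ (n : ℂ)⁻¹) x :=
    hk.div_const.cpow analyticAt_const (by simp [div_self hk₀])
  refine ⟨fun z => (z - x) * (k z / k x) ^ (n : ℂ)⁻¹, by simp, ?_, fun z => ?_⟩
  · have hsub : HasStrictDerivAt (fun z => z - x) 1 x := (hasStrictDerivAt_id x).sub_const x
    exact (hsub.mul hroot.hasStrictDerivAt).congr_deriv (by simp [div_self hk₀])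
  · rw [mul_pow, cpow_nat_inv_pow _ hn]
    field_simp

theorem deriv_ne_zero_of_injOn {f : ℂ → ℂ} {x : ℂ} {s : Set ℂ} (hf : AnalyticAt ℂ f x)
    (hs : s ∈ 𝓝 x) (hinj : InjOn f s) : deriv f x ≠ 0 := by
  intro hderiv
  have hconst : ¬ ∀ᶠ z in 𝓝 x, f z = f x := fun hconst => by
    obtain ⟨z, ⟨hz, hzs⟩, hzx⟩ := (((hconst.and hs).filter_mono
      nhdsWithin_le_nhds).and (self_mem_nhdsWithin : {x}ᶜ ∈ 𝓝[≠] x)).exists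
    exact hzx (hinj hzs (mem_of_mem_nhds hs) hz)
  obtain ⟨n, k, hn, hk, hk₀, hn₁, hfk⟩ := exists_eventually_sub_eq_pow_mul hf hconst
  obtain ⟨ψ, hψ₀, hψ, hpow⟩ := exists_hasStrictDerivAt_pow_eq hn hk hk₀
  have hroot := isPrimitiveRoot_exp n hn
  set ζ := exp (2 * π * I / n)
  have hζ : ζ ≠ 1 := hroot.ne_one (by grind)
  have himage : ψ '' {z | f z - f x = k x * ψ z ^ n ∧ z ∈ s} ∈ 𝓝 (0 : ℂ) := by
    rw [← hψ₀, ← hψ.map_nhds_eq one_ne_zero]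
    exact image_mem_map ((hfk.mono fun z hz => hz.trans (hpow z)).and hs)
  have hmul : ∀ᶠ w in 𝓝 (0 : ℂ), ζ * w ∈ ψ '' {z | f z - f x = k x * ψ z ^ n ∧ z ∈ s} :=
    ((continuous_const_mul ζ).tendsto 0).eventually (by rwa [mul_zero])
  obtain ⟨w, ⟨⟨a, ⟨ha, has⟩, rfl⟩, b, ⟨hb, hbs⟩, hab⟩, hw⟩ :=
    (((eventually_mem_set.2 himage).and hmul |>.filter_mono nhdsWithin_le_nhds).and
      (self_mem_nhdsWithin : {0}ᶜ ∈ 𝓝[≠] (0 : ℂ))).exists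
  have hfab : f b = f a := by
    rw [hab, mul_pow, hroot.pow_eq_one, one_mul, ← ha] at hb
    exact sub_left_injective hb
  rw [hinj hbs has hfab] at hab
  exact hζ (mul_right_cancel₀ hw (by rw [← hab, one_mul]))

theorem contDiffAt_comp_of_analyticAt {E : Type*} [NormedAddCommGroup E] [NormedSpace ℝ E]
    {f : ℂ → ℂ} {a : E → ℂ} {p : E} (ha : ContDiffAt ℝ ∞ a p) (hf : AnalyticAt ℂ f (a p)) :
    ContDiffAt ℝ ∞ (fun p => f (a p)) p :=
  ContDiffAt.comp p (hf.contDiffAt.restrict_scalars ℝ) ha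

theorem contDiffOn_of_unique_zero {F : ℝ × ℝ → ℝ} {s : Set ℝ} {a b : ℝ} {θ : ℝ → ℝ}
    (hs : IsOpen s) (hθ : ∀ x ∈ s, θ x ∈ Ioo a b ∧ F (x, θ x) = 0)
    (huniq : ∀ x ∈ s, ∀ t ∈ Ioo a b, F (x, t) = 0 → t = θ x)
    (hF : ∀ x ∈ s, ContDiffAt ℝ ∞ F (x, θ x))
    (hD : ∀ x ∈ s, ∃ D : ℝ, D ≠ 0 ∧ HasDerivAt (fun t => F (x, t)) D (θ x)) :
    ContDiffOn ℝ ∞ θ s := by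
  intro x hx
  obtain ⟨D, hD₀, hD⟩ := hD x hx
  have hpartial : fderiv ℝ F (x, θ x) (0, 1) = D :=
    (((hF x hx).differentiableAt (by simp)).hasFDerivAt.comp_hasDerivAt (θ x)
      ((hasDerivAt_const _ x).prodMk (hasDerivAt_id _))).unique hD
  have hinv : (fderiv ℝ F (x, θ x) ∘L .inr ℝ ℝ ℝ).IsInvertible := by
    refine ⟨ContinuousLinearEquiv.unitsEquivAut ℝ (Units.mk0 D hD₀), ?_⟩
    ext
    simp [hpartial]
  have hn : (∞ : WithTop ℕ∞) ≠ 0 := by simp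
  set ψ := (hF x hx).implicitFunction hn hinv
  have hψ : ContDiffAt ℝ ∞ ψ x := (hF x hx).contDiffAt_implicitFunction hn hinv
  have hψx : ψ x = θ x := (hF x hx).implicitFunction_apply_self hn hinv
  have hmem : ∀ᶠ y in 𝓝 x, ψ y ∈ Ioo a b :=
    hψ.continuousAt.eventually (isOpen_Ioo.mem_nhds (by rw [hψx]; exact (hθ x hx).1))
  refine (hψ.congr_of_eventuallyEq ?_).contDiffWithinAt
  filter_upwards [(hF x hx).eventually_apply_implicitFunction hn hinv, hmem, hs.mem_nhds hx]
    with y hzero hy hys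
  exact (huniq y hys _ hy (hzero.trans (hθ x hx).2)).symm

/-! ### Annuli and punctured discs -/

theorem isOpen_annulus (a b : ℝ) : IsOpen (annulus a b) :=
  (isOpen_lt continuous_const continuous_norm).inter (isOpen_lt continuous_norm continuous_const)

theorem annulus_subset_annulus {a b a' b' : ℝ} (ha : a' ≤ a) (hb : b ≤ b') :
    annulus a b ⊆ annulus a' b' :=
  fun _ hz => ⟨ha.trans_lt hz.1, hz.2.trans_le hb⟩

theorem conj_mem_annulus {a b : ℝ} {z : ℂ} (hz : z ∈ annulus a b) : conj z ∈ annulus a b := by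
  simpa only [annulus, mem_ofPred_eq, norm_conj] using hz

theorem isBounded_annulus (a b : ℝ) : Bornology.IsBounded (annulus a b) :=
  isBounded_ball.subset fun _ hz => mem_ball_zero_iff.2 hz.2

theorem closure_annulus_subset (a b : ℝ) : closure (annulus a b) ⊆ {z | a ≤ ‖z‖ ∧ ‖z‖ ≤ b} :=
  closure_minimal (fun _ h => ⟨h.1.le, h.2.le⟩)
    ((isClosed_le continuous_const continuous_norm).inter
      (isClosed_le continuous_norm continuous_const))

theorem norm_mem_of_mem_frontier_annulus {a b : ℝ} {z : ℂ} (hz : z ∈ frontier (annulus a b)) :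
    ‖z‖ = a ∨ ‖z‖ = b := by
  have hcl := closure_annulus_subset a b
  rw [(isOpen_annulus a b).frontier_eq] at hz
  grind [annulus]

theorem sphere_subset_closure_annulus {a b : ℝ} (ha : 0 < a) (hab : a < b) :
    sphere 0 a ⊆ closure (annulus a b) := fun z hz => by
  rw [mem_sphere_zero_iff_norm] at hz
  have hray : Tendsto (fun t : ℝ => t * z) (𝓝[>] 1) (𝓝 z) := by
    have : Continuous fun t : ℝ => t * z := by fun_prop
    simpa using (this.tendsto 1).mono_left nhdsWithin_le_nhds
  refine mem_closure_of_tendsto hray ?_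
  filter_upwards [Ioo_mem_nhdsGT ((one_lt_div ha).2 hab)] with t ht
  have ht₀ : 0 ≤ t := zero_le_one.trans ht.1.le
  rw [annulus, mem_ofPred_eq, norm_mul, Complex.norm_of_nonneg ht₀, hz]
  exact ⟨lt_mul_of_one_lt_left ha ht.1, (lt_div_iff₀ ha).1 ht.2⟩

theorem norm_mul_exp_ofReal_mul_I {ρ : ℝ} (hρ : 0 ≤ ρ) (θ : ℝ) : ‖ρ * exp (θ * I)‖ = ρ := by
  rw [norm_mul, norm_exp_ofReal_mul_I, mul_one, Complex.norm_of_nonneg hρ]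

theorem isPreconnected_annulus (a b : ℝ) : IsPreconnected (annulus a b) := by
  have hpolar : annulus a b =
      (fun p : ℝ × ℝ => p.1 * exp (p.2 * I)) '' ((Ioo a b ∩ Ici 0) ×ˢ univ) := by
    ext z
    refine ⟨fun hz => ⟨(‖z‖, arg z), ⟨⟨hz, norm_nonneg z⟩, mem_univ _⟩,
      norm_mul_exp_arg_mul_I z⟩, ?_⟩
    rintro ⟨⟨ρ, θ⟩, ⟨⟨hρ, hρ₀⟩, -⟩, rfl⟩
    simpa only [annulus, mem_ofPred_eq, norm_mul_exp_ofReal_mul_I (mem_Ici.1 hρ₀), mem_Ioo] using hρ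
  rw [hpolar]
  exact ((ordConnected_Ioo.inter ordConnected_Ici).isPreconnected.prod isPreconnected_univ).image _
    (by fun_prop)

/- The punctured disc is built from the inner disc and the outer annulus, glued at `p`, by adding
points of the closure. -/
theorem isPreconnected_ball_diff {Γ : Set ℂ} {ρ R : ℝ} {p : ℂ} (hΓ : Γ ⊆ sphere 0 ρ)
    (hρ : 0 < ρ) (hR : ρ < R) (hp : p ∈ sphere (0 : ℂ) ρ) (hpΓ : p ∉ Γ) :
    IsPreconnected (ball 0 R \ Γ) := by
  have hinner : sphere (0 : ℂ) ρ ⊆ closure (ball 0 ρ) := by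
    rw [closure_ball _ hρ.ne']
    exact sphere_subset_closedBall
  have houter := sphere_subset_closure_annulus hρ hR
  have hW : IsPreconnected (insert p (ball 0 ρ) ∪ insert p (annulus ρ R)) := by
    refine IsPreconnected.union p (mem_insert _ _) (mem_insert _ _) ?_ ?_
    · exact (convex_ball _ _).isPreconnected.subset_closure (subset_insert _ _)
        (insert_subset (hinner hp) subset_closure)
    · exact (isPreconnected_annulus ρ R).subset_closure (subset_insert _ _)
        (insert_subset (houter hp) subset_closure)
  refine hW.subset_closure ?_ fun z hz => ?_
  · rw [mem_sphere_zero_iff_norm] at hp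
    rintro z ((rfl | hz) | (rfl | hz)) <;> refine ⟨?_, fun h => ?_⟩ <;>
      grind [annulus, mem_ball_zero_iff, mem_sphere_zero_iff_norm]
  · rcases lt_trichotomy ‖z‖ ρ with h | h | h
    · exact subset_closure (Or.inl (Or.inr (mem_ball_zero_iff.2 h)))
    · exact closure_mono (fun w hw => Or.inl (Or.inr hw)) (hinner (mem_sphere_zero_iff_norm.2 h))
    · exact subset_closure (Or.inr (Or.inr ⟨h, mem_ball_zero_iff.1 hz.1⟩))

/-! ### The `q`-Pochhammer symbol -/

/-- The infinite `q`-Pochhammer symbol `(a; q)_∞`, the building block of the theta functions in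
terms of which the canonical map is written. -/
noncomputable def qPochhammer {𝕜 : Type*} [NormedField 𝕜] (q a : 𝕜) : 𝕜 :=
  ∏' k : ℕ, (1 - a * q ^ k)

section QPochhammer

variable {𝕜 : Type*} [NormedField 𝕜] {q : 𝕜}

theorem summable_norm_neg_mul_pow (hq : ‖q‖ < 1) (a : 𝕜) :
    Summable fun k : ℕ => ‖-(a * q ^ k)‖ := by
  simpa only [norm_neg, norm_mul, norm_pow] using
    (summable_geometric_of_lt_one (norm_nonneg q) hq).mul_left ‖a‖

variable [CompleteSpace 𝕜]

theorem multipliable_qPochhammer (hq : ‖q‖ < 1) (a : 𝕜) :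
    Multipliable fun k : ℕ => 1 - a * q ^ k := by
  simpa only [sub_eq_add_neg] using
    multipliable_one_add_of_summable (summable_norm_neg_mul_pow hq a)

theorem tendsto_prod_qPochhammer (hq : ‖q‖ < 1) (a : 𝕜) :
    Tendsto (fun n => ∏ k ∈ Finset.range n, (1 - a * q ^ k)) atTop (𝓝 (qPochhammer q a)) :=
  (multipliable_qPochhammer hq a).hasProd.tendsto_prod_nat

theorem qPochhammer_eq_one_sub_mul (hq : ‖q‖ < 1) (a : 𝕜) :
    qPochhammer q a = (1 - a) * qPochhammer q (q * a) := by
  have hshift : (fun k : ℕ => 1 - a * q ^ (k + 1)) = fun k : ℕ => 1 - q * a * q ^ k :=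
    funext fun k => by ring
  have hmul : Multipliable fun k : ℕ => 1 - a * q ^ (k + 1) :=
    by simpa only [hshift] using multipliable_qPochhammer hq (q * a)
  rw [qPochhammer, tprod_eq_zero_mul' (f := fun k => 1 - a * q ^ k) hmul, hshift, pow_zero,
    mul_one, qPochhammer]

theorem qPochhammer_ne_zero (hq : ‖q‖ < 1) {a : 𝕜} (ha : ‖a‖ < 1) : qPochhammer q a ≠ 0 := by
  have hfactor (k : ℕ) : 1 + -(a * q ^ k) ≠ 0 := fun h => by
    have hnorm : ‖a * q ^ k‖ < 1 := by
      rw [norm_mul, norm_pow]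
      exact mul_lt_one_of_nonneg_of_lt_one_left (norm_nonneg a) ha
        (pow_le_one₀ (norm_nonneg q) hq.le)
    rw [← sub_eq_add_neg, sub_eq_zero] at h
    rw [← h, norm_one] at hnorm
    exact hnorm.false
  simpa only [qPochhammer, sub_eq_add_neg] using
    tprod_one_add_ne_zero_of_summable hfactor (summable_norm_neg_mul_pow hq a)

theorem map_qPochhammer {𝕜' : Type*} [NormedField 𝕜'] (φ : 𝕜 →+* 𝕜') (hφ : Continuous φ)
    (hq : ‖q‖ < 1) (a : 𝕜) : φ (qPochhammer q a) = qPochhammer (φ q) (φ a) := by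
  simpa only [qPochhammer, map_sub, map_one, map_mul, map_pow] using
    (multipliable_qPochhammer hq a).map_tprod φ hφ

end QPochhammer

theorem differentiable_qPochhammer {q : ℂ} (hq : ‖q‖ < 1) : Differentiable ℂ (qPochhammer q) := by
  intro a
  have hsum : Summable fun k : ℕ => (‖a‖ + 1) * ‖q‖ ^ k :=
    (summable_geometric_of_lt_one (norm_nonneg q) hq).mul_left _
  have hprod := hsum.hasProdLocallyUniformlyOn_nat_one_add (f := fun k b => -(b * q ^ k))
    (isOpen_ball (x := 0)) (.of_forall fun k b hb => by
      rw [norm_neg, norm_mul, norm_pow]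
      gcongr
      exact (mem_ball_zero_iff.1 hb).le) (fun k => by fun_prop)
  simp only [← sub_eq_add_neg] at hprod
  exact (hprod.differentiableOn (.of_forall fun s => by
    simpa only [Finset.prod_fn] using DifferentiableOn.finsetProd fun _ _ => by fun_prop)
    isOpen_ball).differentiableAt (isOpen_ball.mem_nhds (by simp))

theorem one_sub_mul_pow_nonneg {q a : ℝ} (hq₀ : 0 ≤ q) (hq₁ : q ≤ 1) (ha : a ≤ 1) (k : ℕ) :
    0 ≤ 1 - a * q ^ k := by
  nlinarith [pow_le_one₀ hq₀ hq₁ (n := k), pow_nonneg hq₀ k]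

theorem qPochhammer_pos {q a : ℝ} (hq₀ : 0 < q) (hq₁ : q < 1) (ha : ‖a‖ < 1) :
    0 < qPochhammer q a := by
  have hq : ‖q‖ < 1 := by rwa [Real.norm_of_nonneg hq₀.le]
  have ha₁ : a ≤ 1 := (le_abs_self a).trans ha.le
  exact (ge_of_tendsto' (tendsto_prod_qPochhammer hq a) fun n =>
    Finset.prod_nonneg fun k _ => one_sub_mul_pow_nonneg hq₀.le hq₁.le ha₁ k).lt_of_ne'
      (qPochhammer_ne_zero hq ha)

theorem qPochhammer_mul_qPochhammer_le {q a y : ℝ} (hq₀ : 0 < q) (hq₁ : q < 1) (ha : 0 < a)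
    (hy : 0 < y) (h₁ : a * y < 1) (h₂ : a / y < 1) :
    qPochhammer q (a * y) * qPochhammer q (a / y) ≤ qPochhammer q a ^ 2 := by
  have hq : ‖q‖ < 1 := by rwa [Real.norm_of_nonneg hq₀.le]
  refine le_of_tendsto_of_tendsto' ((tendsto_prod_qPochhammer hq _).mul
    (tendsto_prod_qPochhammer hq _)) ((tendsto_prod_qPochhammer hq _).pow 2) fun n => ?_
  rw [← Finset.prod_mul_distrib, ← Finset.prod_pow]
  refine Finset.prod_le_prod (fun k _ => mul_nonneg
    (one_sub_mul_pow_nonneg hq₀.le hq₁.le h₁.le k)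
    (one_sub_mul_pow_nonneg hq₀.le hq₁.le h₂.le k)) fun k _ => ?_
  have hdiff : (1 - a * q ^ k) ^ 2 - (1 - a * y * q ^ k) * (1 - a / y * q ^ k) =
      a * q ^ k * ((y - 1) ^ 2 / y) := by
    field_simp
    ring
  exact sub_nonneg.1 (hdiff ▸ by positivity)

theorem qPochhammer_mul_qPochhammer_lt {q a y : ℝ} (hq₀ : 0 < q) (hq₁ : q < 1) (ha : 0 < a)
    (hy : 0 < y) (hy₁ : y ≠ 1) (h₁ : a * y < 1) (h₂ : a / y < 1) :
    qPochhammer q (a * y) * qPochhammer q (a / y) < qPochhammer q a ^ 2 := by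
  have hq : ‖q‖ < 1 := by rwa [Real.norm_of_nonneg hq₀.le]
  have hle : qPochhammer q (q * a * y) * qPochhammer q (q * a / y) ≤ qPochhammer q (q * a) ^ 2 :=
    qPochhammer_mul_qPochhammer_le hq₀ hq₁ (by positivity) hy (by nlinarith) (by
      rw [mul_div_assoc]; nlinarith [div_pos ha hy])
  have ha₁ : a ^ 2 < 1 := by
    have : a ^ 2 = a * y * (a / y) := by field_simp
    rw [this]
    exact mul_lt_one_of_nonneg_of_lt_one_left (by positivity) h₁ h₂.le
  have hpos : 0 < qPochhammer q (q * a) ^ 2 :=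
    pow_pos (qPochhammer_pos hq₀ hq₁ (by rw [Real.norm_of_nonneg (by positivity)]; nlinarith)) 2
  have hfactor : (1 - a * y) * (1 - a / y) < (1 - a) ^ 2 := by
    have hdiff : (1 - a) ^ 2 - (1 - a * y) * (1 - a / y) = a * ((y - 1) ^ 2 / y) := by
      field_simp
      ring
    have : 0 < (y - 1) ^ 2 := by positivity [sub_ne_zero.2 hy₁]
    exact sub_pos.1 (hdiff ▸ by positivity)
  calc qPochhammer q (a * y) * qPochhammer q (a / y)
      = (1 - a * y) * (1 - a / y) *
          (qPochhammer q (q * a * y) * qPochhammer q (q * a / y)) := by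
        rw [qPochhammer_eq_one_sub_mul hq (a * y), qPochhammer_eq_one_sub_mul hq (a / y)]
        ring_nf
    _ ≤ (1 - a * y) * (1 - a / y) * qPochhammer q (q * a) ^ 2 := by
        have := mul_nonneg (sub_nonneg.2 h₁.le) (sub_nonneg.2 h₂.le)
        gcongr
    _ < (1 - a) ^ 2 * qPochhammer q (q * a) ^ 2 := by gcongr
    _ = qPochhammer q a ^ 2 := by rw [qPochhammer_eq_one_sub_mul hq a, mul_pow]

/-! ### The canonical map in closed form -/

/-- The quotient of the theta functions `(qz/x; q)_∞ (qx/z; q)_∞` and `(zx; q)_∞ (q/(zx); q)_∞`,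
where `q = r²`; it is the zero-free factor of the canonical map. -/
noncomputable def thetaQuotient (r x : ℝ) (z : ℂ) : ℂ :=
  qPochhammer ((r : ℂ) ^ 2) (r ^ 2 * z / x) * qPochhammer ((r : ℂ) ^ 2) (r ^ 2 * x / z) /
    (qPochhammer ((r : ℂ) ^ 2) (z * x) * qPochhammer ((r : ℂ) ^ 2) (r ^ 2 / (z * x)))

/-- The canonical conformal map of the annulus `r < |z| < 1` onto a circularly slit disc that sends
`x` to `0`, in the closed form that reflection in the two boundary circles leads to. -/
noncomputable def canonicalMap (r x : ℝ) (z : ℂ) : ℂ := (z - x) * thetaQuotient r x z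

theorem canonicalMap_self (r x : ℝ) : canonicalMap r x x = 0 := by simp [canonicalMap]

theorem canonicalMap_antisymm (r x α : ℝ) : canonicalMap r α x = -canonicalMap r x α := by
  rw [canonicalMap, canonicalMap, thetaQuotient, thetaQuotient, mul_comm (x : ℂ) α]
  ring

section CanonicalMap

variable {r x : ℝ} {z : ℂ} (hr : 0 < r) (hx : x ∈ Ioo r 1)

include hr hx

theorem inner_annulus_subset : annulus (r ^ 2 / x) x ⊆ annulus (r ^ 2 / x) (1 / x) := by
  have hx₀ : 0 < x := hr.trans hx.1
  exact annulus_subset_annulus le_rfl ((le_div_iff₀ hx₀).2 (by nlinarith [hx.2]))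

theorem outer_annulus_subset : annulus x (1 / x) ⊆ annulus (r ^ 2 / x) (1 / x) := by
  have hx₀ : 0 < x := hr.trans hx.1
  exact annulus_subset_annulus ((div_le_iff₀ hx₀).2 (by nlinarith [hx.1])) le_rfl

theorem closure_annulus_one_subset : closure (annulus r 1) ⊆ annulus (r ^ 2 / x) (1 / x) := by
  have hx₀ : 0 < x := hr.trans hx.1
  intro z hz
  have hz' := closure_annulus_subset r 1 hz
  exact ⟨((div_lt_iff₀ hx₀).2 (by nlinarith [hx.1])).trans_le hz'.1,
    hz'.2.trans_lt ((lt_div_iff₀ hx₀).2 (by linarith [hx.2]))⟩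

theorem annulus_one_subset : annulus r 1 ⊆ annulus (r ^ 2 / x) (1 / x) :=
  subset_closure.trans (closure_annulus_one_subset hr hx)

theorem sphere_subset_inner_annulus : sphere 0 r ⊆ annulus (r ^ 2 / x) x := fun z hz => by
  have hx₀ : 0 < x := hr.trans hx.1
  rw [mem_sphere_zero_iff_norm] at hz
  exact ⟨by rw [hz, div_lt_iff₀ hx₀]; nlinarith [hx.1], hz ▸ hx.1⟩

theorem sphere_subset_outer_annulus : sphere 0 1 ⊆ annulus x (1 / x) := fun z hz => by
  have hx₀ : 0 < x := hr.trans hx.1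
  rw [mem_sphere_zero_iff_norm] at hz
  exact ⟨hz ▸ hx.2, by rw [hz, lt_div_iff₀ hx₀]; linarith [hx.2]⟩

theorem ofReal_mem_annulus : (x : ℂ) ∈ annulus r 1 := by
  rwa [annulus, mem_ofPred_eq, Complex.norm_of_nonneg (hr.trans hx.1).le]

theorem ne_zero_of_mem_annulus (hz : z ∈ annulus (r ^ 2 / x) (1 / x)) : z ≠ 0 := by
  have hx₀ : 0 < x := hr.trans hx.1
  exact norm_pos_iff.1 (lt_trans (by positivity) hz.1)

theorem norm_ofReal_sq_lt_one : ‖(r : ℂ) ^ 2‖ < 1 := by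
  rw [norm_pow, Complex.norm_of_nonneg hr.le]
  nlinarith [hx.1, hx.2]

theorem norm_mul_div_lt_one (hz : z ∈ annulus (r ^ 2 / x) (1 / x)) : ‖r ^ 2 * z / x‖ < 1 := by
  have hx₀ : 0 < x := hr.trans hx.1
  rw [norm_div, norm_mul, norm_pow, Complex.norm_of_nonneg hr.le, Complex.norm_of_nonneg hx₀.le,
    div_lt_one hx₀]
  have := (lt_div_iff₀ hx₀).1 hz.2
  nlinarith [hx.1, norm_nonneg z, mul_lt_mul'' hx.1 hx.1 hr.le hr.le]

theorem norm_div_lt_one (hz : z ∈ annulus (r ^ 2 / x) (1 / x)) : ‖r ^ 2 * x / z‖ < 1 := by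
  have hx₀ : 0 < x := hr.trans hx.1
  have hz₀ := norm_pos_iff.2 (ne_zero_of_mem_annulus hr hx hz)
  rw [norm_div, norm_mul, norm_pow, Complex.norm_of_nonneg hr.le, Complex.norm_of_nonneg hx₀.le,
    div_lt_one hz₀]
  have := (div_lt_iff₀ hx₀).1 hz.1
  nlinarith [hx.2]

theorem norm_mul_lt_one (hz : z ∈ annulus (r ^ 2 / x) (1 / x)) : ‖z * x‖ < 1 := by
  have hx₀ : 0 < x := hr.trans hx.1
  rw [norm_mul, Complex.norm_of_nonneg hx₀.le]
  exact (lt_div_iff₀ hx₀).1 hz.2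

theorem norm_div_mul_lt_one (hz : z ∈ annulus (r ^ 2 / x) (1 / x)) : ‖r ^ 2 / (z * x)‖ < 1 := by
  have hx₀ : 0 < x := hr.trans hx.1
  have hz₀ := norm_pos_iff.2 (ne_zero_of_mem_annulus hr hx hz)
  rw [norm_div, norm_mul, norm_pow, Complex.norm_of_nonneg hr.le, Complex.norm_of_nonneg hx₀.le,
    div_lt_one (by positivity)]
  exact (div_lt_iff₀ hx₀).1 hz.1

theorem thetaQuotient_ne_zero (hz : z ∈ annulus (r ^ 2 / x) (1 / x)) :
    thetaQuotient r x z ≠ 0 := by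
  have hq := norm_ofReal_sq_lt_one hr hx
  exact div_ne_zero
    (mul_ne_zero (qPochhammer_ne_zero hq (norm_mul_div_lt_one hr hx hz))
      (qPochhammer_ne_zero hq (norm_div_lt_one hr hx hz)))
    (mul_ne_zero (qPochhammer_ne_zero hq (norm_mul_lt_one hr hx hz))
      (qPochhammer_ne_zero hq (norm_div_mul_lt_one hr hx hz)))

theorem canonicalMap_ne_zero (hz : z ∈ annulus (r ^ 2 / x) (1 / x)) (hzx : z ≠ x) :
    canonicalMap r x z ≠ 0 :=
  mul_ne_zero (sub_ne_zero.2 hzx) (thetaQuotient_ne_zero hr hx hz)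

theorem canonicalMap_ne_zero_of_norm_ne (hz : z ∈ annulus (r ^ 2 / x) (1 / x)) (hzx : ‖z‖ ≠ x) :
    canonicalMap r x z ≠ 0 :=
  canonicalMap_ne_zero hr hx hz fun h => hzx (by
    rw [h, Complex.norm_of_nonneg (hr.trans hx.1).le])

theorem differentiableOn_thetaQuotient :
    DifferentiableOn ℂ (thetaQuotient r x) (annulus (r ^ 2 / x) (1 / x)) := fun z hz => by
  have hq := norm_ofReal_sq_lt_one hr hx
  have hT := differentiable_qPochhammer hq
  have hx₀ : (x : ℂ) ≠ 0 := ofReal_ne_zero.2 (hr.trans hx.1).ne'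
  have hz₀ := ne_zero_of_mem_annulus hr hx hz
  have hden := mul_ne_zero (qPochhammer_ne_zero hq (norm_mul_lt_one hr hx hz))
    (qPochhammer_ne_zero hq (norm_div_mul_lt_one hr hx hz))
  have hcomp {a : ℂ → ℂ} (ha : DifferentiableAt ℂ a z) :
      DifferentiableAt ℂ (fun z => qPochhammer ((r : ℂ) ^ 2) (a z)) z := (hT (a z)).comp z ha
  have h₁ := hcomp (a := fun z => r ^ 2 * z / x) (by fun_prop)
  have h₂ := hcomp (a := fun z => r ^ 2 * x / z) (by fun_prop (disch := exact hz₀))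
  have h₃ := hcomp (a := fun z => z * x) (by fun_prop)
  have h₄ := hcomp (a := fun z => r ^ 2 / (z * x))
    (by fun_prop (disch := exact mul_ne_zero hz₀ hx₀))
  exact ((h₁.mul h₂).div (h₃.mul h₄) hden).differentiableWithinAt

theorem differentiableOn_canonicalMap :
    DifferentiableOn ℂ (canonicalMap r x) (annulus (r ^ 2 / x) (1 / x)) :=
  DifferentiableOn.mul (by fun_prop) (differentiableOn_thetaQuotient hr hx)

theorem analyticAt_canonicalMap (hz : z ∈ annulus (r ^ 2 / x) (1 / x)) :
    AnalyticAt ℂ (canonicalMap r x) z :=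
  (differentiableOn_canonicalMap hr hx).analyticAt ((isOpen_annulus _ _).mem_nhds hz)

theorem contDiffAt_canonicalMap (hz : z ∈ annulus (r ^ 2 / x) (1 / x)) :
    ContDiffAt ℝ ∞ (fun p : ℝ × ℂ => canonicalMap r p.1 p.2) (x, z) := by
  have hq := norm_ofReal_sq_lt_one hr hx
  have hT (a : ℂ) : AnalyticAt ℂ (qPochhammer ((r : ℂ) ^ 2)) a :=
    (differentiable_qPochhammer hq).analyticAt a
  have hx₀ : (x : ℂ) ≠ 0 := ofReal_ne_zero.2 (hr.trans hx.1).ne'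
  have hz₀ := ne_zero_of_mem_annulus hr hx hz
  have hxs : ContDiffAt ℝ ∞ (fun p : ℝ × ℂ => (p.1 : ℂ)) (x, z) :=
    ofRealCLM.contDiff.contDiffAt.comp _ contDiffAt_fst
  have hzs : ContDiffAt ℝ ∞ (fun p : ℝ × ℂ => p.2) (x, z) := contDiffAt_snd
  have hden := mul_ne_zero (qPochhammer_ne_zero hq (norm_mul_lt_one hr hx hz))
    (qPochhammer_ne_zero hq (norm_div_mul_lt_one hr hx hz))
  simp only [canonicalMap, thetaQuotient, div_eq_mul_inv] at hden ⊢
  exact (hzs.sub hxs).mul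
    (((contDiffAt_comp_of_analyticAt ((contDiffAt_const.mul hzs).mul (hxs.inv hx₀)) (hT _)).mul
      (contDiffAt_comp_of_analyticAt ((contDiffAt_const.mul hxs).mul (hzs.inv hz₀)) (hT _))).mul
    (((contDiffAt_comp_of_analyticAt (hzs.mul hxs) (hT _)).mul
      (contDiffAt_comp_of_analyticAt (contDiffAt_const.mul
        ((hzs.mul hxs).inv (mul_ne_zero hz₀ hx₀))) (hT _))).inv hden))

theorem thetaQuotient_conj (z : ℂ) :
    thetaQuotient r x (conj z) = conj (thetaQuotient r x z) := by
  have hconj (a : ℂ) : conj (qPochhammer ((r : ℂ) ^ 2) a) = qPochhammer ((r : ℂ) ^ 2) (conj a) := by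
    rw [map_qPochhammer _ continuous_conj (norm_ofReal_sq_lt_one hr hx), map_pow, conj_ofReal]
  simp only [thetaQuotient, map_mul, map_div₀, map_pow, conj_ofReal, hconj]

theorem canonicalMap_conj (z : ℂ) : canonicalMap r x (conj z) = conj (canonicalMap r x z) := by
  rw [canonicalMap, canonicalMap, thetaQuotient_conj hr hx, map_mul, map_sub, conj_ofReal]

theorem canonicalMap_im_eq_zero (hz : z.im = 0) : (canonicalMap r x z).im = 0 := by
  rw [← conj_eq_iff_im, ← canonicalMap_conj hr hx, conj_eq_iff_im.2 hz]

theorem canonicalMap_inv_mul (hz : z ∈ annulus x (1 / x)) :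
    canonicalMap r x (1 / z) * canonicalMap r x z = 1 := by
  have hq := norm_ofReal_sq_lt_one hr hx
  have hx₀ : (x : ℂ) ≠ 0 := ofReal_ne_zero.2 (hr.trans hx.1).ne'
  have hz' := outer_annulus_subset hr hx hz
  have hz₀ := ne_zero_of_mem_annulus hr hx hz'
  have hxz : ‖x / z‖ < 1 := by
    rw [norm_div, Complex.norm_of_nonneg (hr.trans hx.1).le,
      div_lt_one (norm_pos_iff.2 hz₀)]
    exact hz.1
  have h₁ := qPochhammer_eq_one_sub_mul hq (z * x)
  have h₂ := qPochhammer_eq_one_sub_mul hq (x / z)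
  have n₁ := h₁ ▸ qPochhammer_ne_zero hq (norm_mul_lt_one hr hx hz')
  have n₂ := h₂ ▸ qPochhammer_ne_zero hq hxz
  have n₃ := qPochhammer_ne_zero hq (norm_mul_div_lt_one hr hx hz')
  have n₄ := qPochhammer_ne_zero hq (norm_div_mul_lt_one hr hx hz')
  have e₁ : (r : ℂ) ^ 2 * (1 / z) / x = r ^ 2 / (z * x) := by field_simp
  have e₂ : (r : ℂ) ^ 2 * x / (1 / z) = r ^ 2 * (z * x) := by field_simp
  have e₃ : 1 / z * (x : ℂ) = x / z := by field_simp
  have e₄ : (r : ℂ) ^ 2 / (x / z) = r ^ 2 * z / x := by field_simp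
  have e₅ : (r : ℂ) ^ 2 * x / z = r ^ 2 * (x / z) := by field_simp
  have e₆ : 1 / z - x = (1 - z * x) / z := by field_simp
  have e₇ : z - x = z * (1 - x / z) := by field_simp
  rw [canonicalMap, thetaQuotient, canonicalMap, thetaQuotient, e₁, e₂, e₃, e₄, e₅, e₆, e₇, h₁, h₂]
  have := left_ne_zero_of_mul n₁
  have := right_ne_zero_of_mul n₁
  have := left_ne_zero_of_mul n₂
  have := right_ne_zero_of_mul n₂
  generalize qPochhammer ((r : ℂ) ^ 2) (r ^ 2 / (z * x)) = A at *
  generalize qPochhammer ((r : ℂ) ^ 2) (r ^ 2 * (z * x)) = B at *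
  generalize qPochhammer ((r : ℂ) ^ 2) (r ^ 2 * (x / z)) = C at *
  generalize qPochhammer ((r : ℂ) ^ 2) (r ^ 2 * z / x) = D at *
  generalize 1 - z * (x : ℂ) = u at *
  generalize 1 - (x : ℂ) / z = v at *
  field_simp

theorem canonicalMap_sq_div_mul (hz : z ∈ annulus (r ^ 2 / x) x) :
    canonicalMap r x (r ^ 2 / z) * canonicalMap r x z = x ^ 2 := by
  have hq := norm_ofReal_sq_lt_one hr hx
  have hx₀ : (x : ℂ) ≠ 0 := ofReal_ne_zero.2 (hr.trans hx.1).ne'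
  have hr₀ : (r : ℂ) ≠ 0 := ofReal_ne_zero.2 hr.ne'
  have hz' := inner_annulus_subset hr hx hz
  have hz₀ := ne_zero_of_mem_annulus hr hx hz'
  have hzx : ‖z / x‖ < 1 := by
    have hx₀ := hr.trans hx.1
    rw [norm_div, Complex.norm_of_nonneg hx₀.le, div_lt_one hx₀]
    exact hz.2
  have h₁ := qPochhammer_eq_one_sub_mul hq (r ^ 2 / (z * x))
  have h₂ := qPochhammer_eq_one_sub_mul hq (z / x)
  have n₁ := h₁ ▸ qPochhammer_ne_zero hq (norm_div_mul_lt_one hr hx hz')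
  have n₂ := h₂ ▸ qPochhammer_ne_zero hq hzx
  have n₃ := qPochhammer_ne_zero hq (norm_div_lt_one hr hx hz')
  have n₄ := qPochhammer_ne_zero hq (norm_mul_lt_one hr hx hz')
  have e₁ : (r : ℂ) ^ 2 * (r ^ 2 / z) / x = r ^ 2 * (r ^ 2 / (z * x)) := by field_simp
  have e₂ : (r : ℂ) ^ 2 * x / (r ^ 2 / z) = z * x := by field_simp
  have e₃ : (r : ℂ) ^ 2 / z * x = r ^ 2 * x / z := by field_simp
  have e₄ : (r : ℂ) ^ 2 / (r ^ 2 * x / z) = z / x := by field_simp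
  have e₅ : (r : ℂ) ^ 2 * z / x = r ^ 2 * (z / x) := by field_simp
  have e₆ : (r : ℂ) ^ 2 / z - x = -x * (1 - r ^ 2 / (z * x)) := by field_simp; ring
  have e₇ : z - x = -x * (1 - z / x) := by field_simp; ring
  rw [canonicalMap, thetaQuotient, canonicalMap, thetaQuotient, e₁, e₂, e₃, e₄, e₅, e₆, e₇, h₁, h₂]
  have := left_ne_zero_of_mul n₁
  have := right_ne_zero_of_mul n₁
  have := left_ne_zero_of_mul n₂
  have := right_ne_zero_of_mul n₂
  generalize qPochhammer ((r : ℂ) ^ 2) (r ^ 2 * (r ^ 2 / (z * x))) = A at *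
  generalize qPochhammer ((r : ℂ) ^ 2) (z * x) = B at *
  generalize qPochhammer ((r : ℂ) ^ 2) (r ^ 2 * x / z) = C at *
  generalize qPochhammer ((r : ℂ) ^ 2) (r ^ 2 * (z / x)) = D at *
  generalize 1 - (r : ℂ) ^ 2 / (z * x) = u at *
  generalize 1 - z / (x : ℂ) = v at *
  field_simp

theorem norm_canonicalMap_of_norm_eq_one (hz : ‖z‖ = 1) : ‖canonicalMap r x z‖ = 1 := by
  have hmem := sphere_subset_outer_annulus hr hx (mem_sphere_zero_iff_norm.2 hz)
  have hinv : 1 / z = conj z := by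
    rw [one_div, inv_def, normSq_eq_norm_sq, hz, one_pow, inv_one, ofReal_one, mul_one]
  have hmul := canonicalMap_inv_mul hr hx hmem
  rw [hinv, canonicalMap_conj hr hx, conj_mul'] at hmul
  exact (pow_eq_one_iff_of_nonneg (norm_nonneg _) two_ne_zero).1 (by exact_mod_cast hmul)

theorem norm_canonicalMap_of_norm_eq (hz : ‖z‖ = r) : ‖canonicalMap r x z‖ = x := by
  have hmem := sphere_subset_inner_annulus hr hx (mem_sphere_zero_iff_norm.2 hz)
  have hinv : r ^ 2 / z = conj z := by
    have hz₀ := ne_zero_of_mem_annulus hr hx (inner_annulus_subset hr hx hmem)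
    rw [div_eq_iff hz₀, conj_mul', hz]
  have hmul := canonicalMap_sq_div_mul hr hx hmem
  rw [hinv, canonicalMap_conj hr hx, conj_mul'] at hmul
  exact (sq_eq_sq₀ (norm_nonneg _) (hr.trans hx.1).le).1 (by exact_mod_cast hmul)

theorem hasDerivAt_canonicalMap_self :
    HasDerivAt (canonicalMap r x) (thetaQuotient r x x) x := by
  have hmem := annulus_one_subset hr hx (ofReal_mem_annulus hr hx)
  have hg := ((differentiableOn_thetaQuotient hr hx).differentiableAt
    ((isOpen_annulus _ _).mem_nhds hmem)).hasDerivAt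
  refine (((hasDerivAt_id (x : ℂ)).sub_const (x : ℂ)).mul hg).congr_deriv ?_
  rw [id_eq, sub_self, zero_mul, add_zero, one_mul]

theorem exists_thetaQuotient_eq_ofReal_of_im_eq_zero (hz : z ∈ annulus (r ^ 2 / x) (1 / x))
    (hi : z.im = 0) : ∃ d : ℝ, 0 < d ∧ thetaQuotient r x z = d := by
  obtain ⟨t, rfl⟩ : ∃ t : ℝ, (t : ℂ) = z := ⟨z.re, Complex.ext (ofReal_re _) (by simp [hi])⟩
  have hq : ‖r ^ 2‖ < 1 := by exact_mod_cast norm_ofReal_sq_lt_one hr hx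
  have hq₁ : r ^ 2 < 1 := by rwa [Real.norm_of_nonneg (by positivity)] at hq
  have hcast (a : ℝ) : qPochhammer ((r : ℂ) ^ 2) a = (qPochhammer (r ^ 2) a : ℝ) := by
    simpa using (map_qPochhammer ofRealHom continuous_ofReal hq a).symm
  have h₁ : ‖r ^ 2 * t / x‖ < 1 := by exact_mod_cast norm_mul_div_lt_one hr hx hz
  have h₂ : ‖r ^ 2 * x / t‖ < 1 := by exact_mod_cast norm_div_lt_one hr hx hz
  have h₃ : ‖t * x‖ < 1 := by exact_mod_cast norm_mul_lt_one hr hx hz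
  have h₄ : ‖r ^ 2 / (t * x)‖ < 1 := by exact_mod_cast norm_div_mul_lt_one hr hx hz
  have hpos {a : ℝ} (ha : ‖a‖ < 1) := qPochhammer_pos (sq_pos_of_pos hr) hq₁ ha
  refine ⟨_, div_pos (mul_pos (hpos h₁) (hpos h₂)) (mul_pos (hpos h₃) (hpos h₄)), ?_⟩
  simp only [thetaQuotient, ofReal_div, ofReal_mul, ← hcast, ofReal_pow]

theorem canonicalMap_eq_neg_of_norm_eq_of_im_eq_zero (hz : ‖z‖ = r) (hi : z.im = 0) :
    canonicalMap r x z = -x := by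
  have hmem := sphere_subset_inner_annulus hr hx (mem_sphere_zero_iff_norm.2 hz)
  obtain ⟨d, hd, hdz⟩ :=
    exists_thetaQuotient_eq_ofReal_of_im_eq_zero hr hx (inner_annulus_subset hr hx hmem) hi
  obtain ⟨t, rfl⟩ : ∃ t : ℝ, (t : ℂ) = z := ⟨z.re, Complex.ext (ofReal_re _) (by simp [hi])⟩
  have htx : t < x := by
    rw [norm_real] at hz
    exact (le_abs_self t).trans_lt (hz.trans_lt hx.1)
  have hnorm := norm_canonicalMap_of_norm_eq hr hx hz
  rw [canonicalMap, hdz, ← ofReal_sub, ← ofReal_mul] at hnorm ⊢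
  rw [norm_real, Real.norm_of_nonpos (mul_nonpos_of_nonpos_of_nonneg (sub_neg.2 htx).le hd.le)]
    at hnorm
  rw [← ofReal_neg]
  exact congrArg ofReal (by linarith)

theorem exists_thetaQuotient_self_eq_ofReal :
    ∃ d : ℝ, thetaQuotient r x x = d ∧ 1 / (1 - x ^ 2) < d := by
  have hx₀ := hr.trans hx.1
  have hq₁ : r ^ 2 < 1 := by nlinarith [hx.1, hx.2]
  have hq : ‖r ^ 2‖ < 1 := by rwa [Real.norm_of_nonneg (by positivity)]
  have hx₁ : x ^ 2 < 1 := by nlinarith [hx.2]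
  have hrx : r ^ 2 / x ^ 2 < 1 := by rw [div_lt_one (by positivity)]; nlinarith [hx.1]
  have hcast (a : ℝ) : qPochhammer ((r : ℂ) ^ 2) a = (qPochhammer (r ^ 2) a : ℝ) := by
    simpa using (map_qPochhammer ofRealHom continuous_ofReal hq a).symm
  refine ⟨qPochhammer (r ^ 2) (r ^ 2) ^ 2 /
    ((1 - x ^ 2) * (qPochhammer (r ^ 2) (r ^ 2 * x ^ 2) *
      qPochhammer (r ^ 2) (r ^ 2 / x ^ 2))), ?_, ?_⟩
  · have e₁ : (r : ℂ) ^ 2 * x / x = (r ^ 2 : ℝ) := by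
      rw [mul_div_cancel_right₀ _ (ofReal_ne_zero.2 hx₀.ne'), ofReal_pow]
    have e₂ : (r : ℂ) ^ 2 / (x * x) = (r ^ 2 / x ^ 2 : ℝ) := by push_cast; ring
    have e₃ : (x * x : ℂ) = (x ^ 2 : ℝ) := by push_cast; ring
    rw [thetaQuotient, e₁, e₂, e₃, hcast, hcast, hcast, qPochhammer_eq_one_sub_mul hq (x ^ 2)]
    push_cast
    ring
  · have hlt := qPochhammer_mul_qPochhammer_lt (a := r ^ 2) (y := x ^ 2) (by positivity) hq₁
      (by positivity) (by positivity) hx₁.ne (by nlinarith) hrx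
    have hpos : 0 < qPochhammer (r ^ 2) (r ^ 2 * x ^ 2) * qPochhammer (r ^ 2) (r ^ 2 / x ^ 2) :=
      mul_pos
        (qPochhammer_pos (by positivity) hq₁ (by
          rw [Real.norm_of_nonneg (by positivity)]; nlinarith))
        (qPochhammer_pos (by positivity) hq₁ (by rwa [Real.norm_of_nonneg (by positivity)]))
    rw [div_lt_div_iff₀ (sub_pos.2 hx₁) (by have := sub_pos.2 hx₁; positivity)]
    have := sub_pos.2 hx₁
    nlinarith

end CanonicalMap

/-! ### The sign of the imaginary part -/

theorem prod_div_eq_norm_mul_exp_sum_arg (a b : ℕ → ℂ) (n : ℕ) :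
    ∏ k ∈ Finset.range n, a k / b k = (∏ k ∈ Finset.range n, ‖a k‖ / ‖b k‖ : ℝ) *
      exp ((∑ k ∈ Finset.range n, (arg (a k) - arg (b k)) : ℝ) * I) := by
  have hdiv (w v : ℂ) : w / v = (‖w‖ / ‖v‖ : ℝ) * exp ((arg w - arg v : ℝ) * I) := by
    rw [ofReal_sub, sub_mul, exp_sub, ofReal_div, div_mul_div_comm, norm_mul_exp_arg_mul_I,
      norm_mul_exp_arg_mul_I]
  rw [ofReal_sum, Finset.sum_mul, exp_sum, ofReal_prod, ← Finset.prod_mul_distrib]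
  exact Finset.prod_congr rfl fun k _ => hdiv (a k) (b k)

theorem monotone_arg_sub_ofReal {z : ℂ} (hz : 0 < z.im) : Monotone fun t : ℝ => arg (z - t) := by
  intro s t hst
  have him (a : ℝ) : 0 < (z - a).im := by simpa using hz
  by_contra! hlt
  have hsin : 0 < Real.sin (arg (z - s) - arg (z - t)) :=
    Real.sin_pos_of_pos_of_lt_pi (sub_pos.2 hlt)
      ((sub_le_self _ (arg_nonneg_iff.2 (him t).le)).trans_lt (arg_lt_pi_iff.2 (.inr (him s).ne')))
  have hne (a : ℝ) : z - a ≠ 0 := fun h => (him a).ne' (by rw [h, zero_im])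
  rw [Real.sin_sub, sin_arg, sin_arg, cos_arg (hne s), cos_arg (hne t), div_mul_div_comm,
    div_mul_div_comm, ← sub_div] at hsin
  have hcross := (div_pos_iff_of_pos_right
    (mul_pos (norm_pos_iff.2 (hne s)) (norm_pos_iff.2 (hne t)))).1 hsin
  simp only [sub_im, ofReal_im, sub_zero, sub_re, ofReal_re] at hcross
  nlinarith

theorem sum_sub_mem_Icc_of_interlacing {α β : ℕ → ℝ} (hαβ : ∀ k, α k ≤ β k)
    (hβα : ∀ k, β k ≤ α (k + 1)) (n : ℕ) :
    ∑ k ∈ Finset.range n, (α (k + 1) - β k) ∈ Icc 0 (α n - α 0) := by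
  refine ⟨Finset.sum_nonneg fun k _ => sub_nonneg.2 (hβα k), ?_⟩
  rw [← Finset.sum_range_sub]
  exact Finset.sum_le_sum fun k _ => sub_le_sub_left (hαβ k) _

/- The argument of the product is `arg (z - u 0)` plus a sum of differences of the increasing
function `t ↦ arg (z - t)`; by interlacing it stays between `arg (z - v n)` and `arg (z - u n)`. -/
theorem im_mul_prod_nonneg_of_interlacing {z : ℂ} (hz : 0 < z.im) {u u' v v' : ℕ → ℝ}
    (hu : ∀ k, u k ≤ u' k) (hu' : ∀ k, u' k ≤ u (k + 1)) (hv : ∀ k, v' k ≤ v k)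
    (hv' : ∀ k, v (k + 1) ≤ v' k) (huv : u 0 = v 0) (n : ℕ) :
    0 ≤ ((z - u 0) * ((∏ k ∈ Finset.range n, (z - u (k + 1)) / (z - u' k)) *
      ∏ k ∈ Finset.range n, (z - v (k + 1)) / (z - v' k))).im := by
  have hmono := monotone_arg_sub_ofReal hz
  have hu_sum := sum_sub_mem_Icc_of_interlacing (fun k => hmono (hu k)) (fun k => hmono (hu' k)) n
  have hv_sum := sum_sub_mem_Icc_of_interlacing (fun k => neg_le_neg (hmono (hv k)))
    (fun k => neg_le_neg (hmono (hv' k))) n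
  rw [prod_div_eq_norm_mul_exp_sum_arg, prod_div_eq_norm_mul_exp_sum_arg,
    ← norm_mul_exp_arg_mul_I (z - u 0)]
  set R := ∏ k ∈ Finset.range n, ‖z - u (k + 1)‖ / ‖z - u' k‖
  set S := ∏ k ∈ Finset.range n, ‖z - v (k + 1)‖ / ‖z - v' k‖
  set Φ := ∑ k ∈ Finset.range n, (arg (z - u (k + 1)) - arg (z - u' k))
  have hΨ : ∑ k ∈ Finset.range n, (-arg (z - v (k + 1)) - -arg (z - v' k)) =
      -∑ k ∈ Finset.range n, (arg (z - v (k + 1)) - arg (z - v' k)) := by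
    rw [← Finset.sum_neg_distrib]
    exact Finset.sum_congr rfl fun k _ => by ring
  rw [hΨ] at hv_sum
  set Ψ := ∑ k ∈ Finset.range n, (arg (z - v (k + 1)) - arg (z - v' k))
  have harg (t : ℝ) : arg (z - t) ∈ Icc 0 π :=
    ⟨arg_nonneg_iff.2 (by simpa using hz.le), arg_le_pi _⟩
  have hsin : 0 ≤ Real.sin (arg (z - u 0) + Φ + Ψ) := by
    refine Real.sin_nonneg_of_nonneg_of_le_pi ?_ ?_
    · have h₁ := hv_sum.2
      have h₂ := (harg (v n)).1
      rw [← huv] at h₁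
      linarith [hu_sum.1]
    · linarith [hu_sum.2, hv_sum.1, (harg (u n)).2]
  have hprod : ‖z - u 0‖ * exp (arg (z - u 0) * I) * (R * exp (Φ * I) * (S * exp (Ψ * I))) =
      (‖z - u 0‖ * R * S : ℝ) * exp ((arg (z - u 0) + Φ + Ψ : ℝ) * I) := by
    push_cast
    rw [add_mul, add_mul, exp_add, exp_add]
    ring
  rw [hprod, im_ofReal_mul, exp_ofReal_mul_I_im]
  positivity

section CanonicalMap

variable {r x : ℝ} {z : ℂ} (hr : 0 < r) (hx : x ∈ Ioo r 1)

include hr hx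

theorem thetaQuotient_factor_eq (hz : 0 < z.im) (k : ℕ) :
    (1 - r ^ 2 * z / x * ((r : ℂ) ^ 2) ^ k) * (1 - r ^ 2 * x / z * ((r : ℂ) ^ 2) ^ k) /
      ((1 - z * x * ((r : ℂ) ^ 2) ^ k) * (1 - r ^ 2 / (z * x) * ((r : ℂ) ^ 2) ^ k)) =
    (r ^ 2 / x ^ 2 : ℝ) *
      ((z - (x / (r ^ 2) ^ (k + 1) : ℝ)) / (z - (1 / (x * (r ^ 2) ^ k) : ℝ)) *
        ((z - (x * (r ^ 2) ^ (k + 1) : ℝ)) / (z - ((r ^ 2) ^ (k + 1) / x : ℝ)))) := by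
  have hx₀ : (x : ℂ) ≠ 0 := ofReal_ne_zero.2 (hr.trans hx.1).ne'
  have hr₀ : (r : ℂ) ≠ 0 := ofReal_ne_zero.2 hr.ne'
  have hne (t : ℝ) : z - t ≠ 0 := fun h => hz.ne' (by simpa using congrArg im h)
  have hz₀ : z ≠ 0 := by simpa using hne 0
  have h₂ := hne (1 / (x * (r ^ 2) ^ k))
  have h₄ := hne ((r ^ 2) ^ (k + 1) / x)
  have e₁ : 1 - r ^ 2 * z / x * ((r : ℂ) ^ 2) ^ k =
      -((r ^ 2) ^ (k + 1) / x) * (z - (x / (r ^ 2) ^ (k + 1) : ℝ)) := by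
    push_cast; field_simp; ring
  have e₂ : 1 - z * x * ((r : ℂ) ^ 2) ^ k =
      -(x * (r ^ 2) ^ k) * (z - (1 / (x * (r ^ 2) ^ k) : ℝ)) := by
    push_cast; field_simp; ring
  have e₃ : 1 - r ^ 2 * x / z * ((r : ℂ) ^ 2) ^ k = (z - (x * (r ^ 2) ^ (k + 1) : ℝ)) / z := by
    push_cast; field_simp; ring
  have e₄ : 1 - r ^ 2 / (z * x) * ((r : ℂ) ^ 2) ^ k = (z - ((r ^ 2) ^ (k + 1) / x : ℝ)) / z := by
    push_cast; field_simp; ring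
  rw [e₁, e₂, e₃, e₄]
  generalize z - ((1 / (x * (r ^ 2) ^ k) : ℝ) : ℂ) = b at *
  generalize z - (((r ^ 2) ^ (k + 1) / x : ℝ) : ℂ) = d at *
  push_cast
  field_simp
  ring

theorem tendsto_prod_canonicalMap (hz : z ∈ annulus (r ^ 2 / x) (1 / x)) (hi : 0 < z.im) :
    Tendsto (fun n => ((r ^ 2 / x ^ 2 : ℝ) : ℂ) ^ n *
      ((z - x) * ((∏ k ∈ Finset.range n,
          (z - (x / (r ^ 2) ^ (k + 1) : ℝ)) / (z - (1 / (x * (r ^ 2) ^ k) : ℝ))) *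
        ∏ k ∈ Finset.range n,
          (z - (x * (r ^ 2) ^ (k + 1) : ℝ)) / (z - ((r ^ 2) ^ (k + 1) / x : ℝ)))))
      atTop (𝓝 (canonicalMap r x z)) := by
  have hq := norm_ofReal_sq_lt_one hr hx
  have hlim := (((tendsto_prod_qPochhammer hq (r ^ 2 * z / x)).mul
    (tendsto_prod_qPochhammer hq (r ^ 2 * x / z))).div
      ((tendsto_prod_qPochhammer hq (z * x)).mul
        (tendsto_prod_qPochhammer hq (r ^ 2 / (z * x))))
      (mul_ne_zero (qPochhammer_ne_zero hq (norm_mul_lt_one hr hx hz))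
        (qPochhammer_ne_zero hq (norm_div_mul_lt_one hr hx hz)))).const_mul (z - x : ℂ)
  refine hlim.congr fun n => ?_
  simp only [Pi.div_apply]
  rw [← Finset.prod_mul_distrib, ← Finset.prod_mul_distrib, ← Finset.prod_div_distrib,
    Finset.prod_congr rfl fun k _ => thetaQuotient_factor_eq hr hx hi k, Finset.prod_mul_distrib,
    Finset.prod_mul_distrib, Finset.prod_const, Finset.card_range]
  ring

theorem canonicalMap_im_nonneg (hz : z ∈ annulus (r ^ 2 / x) (1 / x)) (hi : 0 < z.im) :
    0 ≤ (canonicalMap r x z).im := by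
  have hx₀ := hr.trans hx.1
  have hq₀ : 0 < r ^ 2 := by positivity
  have hqx : r ^ 2 ≤ x * x := by nlinarith [hx.1]
  have hxx : x * x ≤ 1 := by nlinarith [hx.2]
  refine ge_of_tendsto' ((continuous_im.tendsto _).comp
    (tendsto_prod_canonicalMap hr hx hz hi)) fun n => ?_
  rw [Function.comp_apply, ← ofReal_pow, im_ofReal_mul]
  refine mul_nonneg (by positivity) ?_
  have hpow (k : ℕ) : 0 < (r ^ 2) ^ k := pow_pos hq₀ k
  have := im_mul_prod_nonneg_of_interlacing hi (u := fun k => x / (r ^ 2) ^ k)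
    (u' := fun k => 1 / (x * (r ^ 2) ^ k)) (v := fun k => x * (r ^ 2) ^ k)
    (v' := fun k => (r ^ 2) ^ (k + 1) / x)
    (fun k => ?_) (fun k => ?_) (fun k => ?_) (fun k => ?_) (by simp) n
  · simpa using this
  all_goals have := hpow k
  · rw [div_le_div_iff₀ (by positivity) (by positivity)]
    nlinarith
  · rw [div_le_div_iff₀ (by positivity) (by positivity), pow_succ]
    nlinarith
  · rw [div_le_iff₀ hx₀, pow_succ]
    nlinarith
  · rw [le_div_iff₀ hx₀, pow_succ]
    nlinarith [mul_pos this hq₀]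

theorem isOpen_image_canonicalMap {s : Set ℂ} (hs : s ⊆ annulus (r ^ 2 / x) (1 / x))
    (ho : IsOpen s) :
    IsOpen (canonicalMap r x '' s) := by
  have han : AnalyticOnNhd ℂ (canonicalMap r x) (annulus (r ^ 2 / x) (1 / x)) :=
    fun z hz => analyticAt_canonicalMap hr hx hz
  refine (han.is_constant_or_isOpen (isPreconnected_annulus _ _)).elim ?_ fun h => h s hs ho
  rintro ⟨c, hc⟩
  have hone : ‖(1 : ℂ)‖ = 1 := norm_one
  have h₁ := sphere_subset_outer_annulus hr hx (mem_sphere_zero_iff_norm.2 hone)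
  have hne := canonicalMap_ne_zero_of_norm_ne hr hx (outer_annulus_subset hr hx h₁) h₁.1.ne'
  refine absurd ?_ hne
  rw [hc _ (outer_annulus_subset hr hx h₁),
    ← hc _ (annulus_one_subset hr hx (ofReal_mem_annulus hr hx)), canonicalMap_self]

theorem canonicalMap_im_pos (hz : z ∈ annulus (r ^ 2 / x) (1 / x)) (hi : 0 < z.im) :
    0 < (canonicalMap r x z).im := by
  have hopen := isOpen_image_canonicalMap hr hx
    (s := annulus (r ^ 2 / x) (1 / x) ∩ {z | 0 < z.im}) inter_subset_left
    ((isOpen_annulus _ _).inter (isOpen_lt continuous_const continuous_im))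
  have hsub : canonicalMap r x '' (annulus (r ^ 2 / x) (1 / x) ∩ {z | 0 < z.im}) ⊆
      {w | 0 ≤ w.im} := by
    rintro _ ⟨w, hw, rfl⟩
    exact canonicalMap_im_nonneg hr hx hw.1 hw.2
  have hmem := interior_maximal hsub hopen ⟨z, ⟨hz, hi⟩, rfl⟩
  rwa [interior_setOfPred_le_im] at hmem

theorem canonicalMap_im_neg (hz : z ∈ annulus (r ^ 2 / x) (1 / x)) (hi : z.im < 0) :
    (canonicalMap r x z).im < 0 := by
  have := canonicalMap_im_pos hr hx (conj_mem_annulus hz) (by simpa using hi)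
  rwa [canonicalMap_conj hr hx, conj_im, neg_pos] at this

theorem sign_canonicalMap_im (hz : z ∈ annulus (r ^ 2 / x) (1 / x)) :
    SignType.sign (canonicalMap r x z).im = SignType.sign z.im := by
  rcases lt_trichotomy z.im 0 with h | h | h
  · rw [sign_neg h, sign_neg (canonicalMap_im_neg hr hx hz h)]
  · rw [h, canonicalMap_im_eq_zero hr hx h]
  · rw [sign_pos h, sign_pos (canonicalMap_im_pos hr hx hz h)]

theorem norm_canonicalMap_lt_one (hz : z ∈ annulus r 1) : ‖canonicalMap r x z‖ < 1 := by
  have hle : canonicalMap r x '' annulus r 1 ⊆ closedBall 0 1 := by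
    rintro _ ⟨w, hw, rfl⟩
    rw [mem_closedBall_zero_iff]
    refine norm_le_of_forall_mem_frontier_norm_le (isBounded_annulus r 1)
      ((differentiableOn_canonicalMap hr hx).mono
        (closure_annulus_one_subset hr hx)).diffContOnCl (fun ζ hζ => ?_) (subset_closure hw)
    rcases norm_mem_of_mem_frontier_annulus hζ with h | h
    · exact (norm_canonicalMap_of_norm_eq hr hx h).trans_le hx.2.le
    · exact (norm_canonicalMap_of_norm_eq_one hr hx h).le
  have hmem := interior_maximal hle
    (isOpen_image_canonicalMap hr hx (annulus_one_subset hr hx) (isOpen_annulus r 1)) ⟨z, hz, rfl⟩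
  rwa [interior_closedBall _ one_ne_zero, mem_ball_zero_iff] at hmem

end CanonicalMap

/-! ### Injectivity -/

/-- The part of the annulus `a < |z| < b` that lies in the open upper half-plane. -/
def upperHalfAnnulus (a b : ℝ) : Set ℂ := annulus a b ∩ {z | 0 < z.im}

theorem isOpen_upperHalfAnnulus (a b : ℝ) : IsOpen (upperHalfAnnulus a b) :=
  (isOpen_annulus a b).inter (isOpen_lt continuous_const continuous_im)

theorem annulus_inter_im_nonneg_subset_closure (a b : ℝ) :
    annulus a b ∩ {z | 0 ≤ z.im} ⊆ closure (upperHalfAnnulus a b) := by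
  rw [← Complex.closure_setOfPred_lt_im]
  exact (isOpen_annulus a b).inter_closure

theorem mem_of_mem_frontier_upperHalfAnnulus {a b : ℝ} {z : ℂ}
    (hz : z ∈ frontier (upperHalfAnnulus a b)) : ‖z‖ = a ∨ ‖z‖ = b ∨ z.im = 0 := by
  rcases frontier_inter_subset _ _ hz with ⟨h, -⟩ | ⟨-, h⟩
  · exact (norm_mem_of_mem_frontier_annulus h).imp_right Or.inl
  · rw [Complex.frontier_setOfPred_lt_im] at h
    exact Or.inr (Or.inr h)

theorem ne_ofReal_of_im_pos {z : ℂ} (hz : 0 < z.im) (x : ℝ) : z ≠ x := by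
  rintro rfl
  exact hz.ne' (ofReal_im x)

theorem arg_mem_Ioo_of_im_pos {z : ℂ} (hz : 0 < z.im) : arg z ∈ Ioo 0 π :=
  ⟨(arg_nonneg_iff.2 hz.le).lt_of_ne fun h => hz.ne' (arg_eq_zero_iff.1 h.symm).2,
    arg_lt_pi_iff.2 (Or.inr hz.ne')⟩

theorem convex_reProdIm {s t : Set ℝ} (hs : Convex ℝ s) (ht : Convex ℝ t) :
    Convex ℝ (s ×ℂ t) :=
  (hs.linear_preimage reLm).inter (ht.linear_preimage imLm)

theorem image_exp_reProdIm {a b : ℝ} (ha : 0 < a) (hb : 0 < b) :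
    exp '' (Ioo (Real.log a) (Real.log b) ×ℂ Ioo 0 π) = upperHalfAnnulus a b := by
  ext z
  constructor
  · rintro ⟨w, ⟨hre, him⟩, rfl⟩
    refine ⟨?_, ?_⟩
    · rw [annulus, mem_ofPred_eq, norm_exp]
      exact ⟨(Real.log_lt_iff_lt_exp ha).1 hre.1, (Real.lt_log_iff_exp_lt hb).1 hre.2⟩
    · rw [mem_ofPred_eq, exp_im]
      exact mul_pos (Real.exp_pos _) (Real.sin_pos_of_mem_Ioo him)
  · rintro ⟨⟨h₁, h₂⟩, him : 0 < z.im⟩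
    have hz : z ≠ 0 := fun h => by simp [h] at him
    refine ⟨log z, ⟨?_, ?_⟩, exp_log hz⟩
    · rw [mem_preimage, log_re]
      exact ⟨Real.log_lt_log ha h₁, Real.log_lt_log (ha.trans h₁) h₂⟩
    · rw [mem_preimage, log_im]
      exact arg_mem_Ioo_of_im_pos him

theorem isPreconnected_upperHalfAnnulus {a b : ℝ} (ha : 0 < a) (hb : 0 < b) :
    IsPreconnected (upperHalfAnnulus a b) := by
  rw [← image_exp_reProdIm ha hb]
  exact (convex_reProdIm (convex_Ioo _ _) (convex_Ioo _ _)).isPreconnected.image _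
    continuous_exp.continuousOn

/-- The logarithmic derivative of `f` with respect to `log z`. On a circle `|z| = ρ` its real part
is the rate of change of `arg f`, and the negative of its imaginary part that of `log |f|`. -/
noncomputable def eulerLogDeriv (f : ℂ → ℂ) (z : ℂ) : ℂ := z * logDeriv f z

theorem analyticAt_eulerLogDeriv {f : ℂ → ℂ} {z : ℂ} (hf : AnalyticAt ℂ f z) (hz : f z ≠ 0) :
    AnalyticAt ℂ (eulerLogDeriv f) z :=
  analyticAt_id.mul (hf.deriv.div hf hz)

theorem hasDerivAt_comp_exp {f : ℂ → ℂ} {w : ℂ} (hf : DifferentiableAt ℂ f (exp w))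
    (hw : f (exp w) ≠ 0) :
    HasDerivAt (fun w => f (exp w)) (f (exp w) * eulerLogDeriv f (exp w)) w := by
  refine (hf.hasDerivAt.comp w (hasDerivAt_exp w)).congr_deriv ?_
  rw [eulerLogDeriv, logDeriv_apply]
  field_simp

theorem hasDerivAt_log_comp_exp {f : ℂ → ℂ} {w : ℂ} (hf : DifferentiableAt ℂ f (exp w))
    (hw : f (exp w) ∈ slitPlane) :
    HasDerivAt (fun w => log (f (exp w))) (eulerLogDeriv f (exp w)) w := by
  have hw₀ := slitPlane_ne_zero hw
  refine ((hasDerivAt_comp_exp hf hw₀).clog hw).congr_deriv ?_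
  rw [mul_div_cancel_left₀ _ hw₀]

theorem eulerLogDeriv_conj {f : ℂ → ℂ} (hf : ∀ z, f (conj z) = conj (f z)) (z : ℂ) :
    eulerLogDeriv f (conj z) = conj (eulerLogDeriv f z) := by
  have hconj : conj ∘ f ∘ conj = f := funext fun w => by simp [hf]
  have hderiv : deriv f (conj z) = conj (deriv f z) := by
    conv_lhs => rw [← hconj, deriv_conj_conj]
    simp
  rw [eulerLogDeriv, eulerLogDeriv, logDeriv_apply, logDeriv_apply, hf, hderiv, map_mul, map_div₀]

theorem eulerLogDeriv_im_eq_zero {f : ℂ → ℂ} (hf : ∀ z, f (conj z) = conj (f z)) {z : ℂ}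
    (hz : z.im = 0) : (eulerLogDeriv f z).im = 0 := by
  rw [← conj_eq_iff_im, ← eulerLogDeriv_conj hf, conj_eq_iff_im.2 hz]

theorem eulerLogDeriv_div_eq {f : ℂ → ℂ} {a k z : ℂ} (hk : k ≠ 0) (hz : z ≠ 0)
    (hfz : DifferentiableAt ℂ f z) (hfa : DifferentiableAt ℂ f (a / z))
    (h : ∀ᶠ w in 𝓝 z, f (a / w) * f w = k) : eulerLogDeriv f (a / z) = eulerLogDeriv f z := by
  have hinv : HasDerivAt (fun w => a / w) (-a / z ^ 2) z :=
    ((hasDerivAt_const z a).div (hasDerivAt_id z) hz).congr_deriv (by simp)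
  have hne := mul_ne_zero_iff.1 (h.self_of_nhds.trans_ne hk)
  have hprod := logDeriv_mul z (f := f ∘ fun w => a / w) hne.1 hne.2
    (hfa.comp z hinv.differentiableAt) hfz
  have hconst : logDeriv (fun w => (f ∘ fun w => a / w) w * f w) z = 0 := by
    have hfun : (fun w => (f ∘ fun w => a / w) w * f w) =ᶠ[𝓝 z] fun _ => k := h
    rw [logDeriv_apply, hfun.deriv_eq, deriv_const, zero_div]
  rw [hconst, logDeriv_comp hfa hinv.differentiableAt, hinv.deriv] at hprod
  rw [eulerLogDeriv, eulerLogDeriv, ← sub_eq_zero, ← neg_eq_zero, ← mul_zero z, hprod]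
  field_simp
  ring

theorem eulerLogDeriv_im_eq_zero_of_reflection {f : ℂ → ℂ} {ρ : ℝ} {k z : ℂ}
    (hf : ∀ z, f (conj z) = conj (f z)) (hk : k ≠ 0) (hz : z ≠ 0) (hρ : ‖z‖ = ρ)
    (hfz : DifferentiableAt ℂ f z) (hfc : DifferentiableAt ℂ f (conj z))
    (h : ∀ᶠ w in 𝓝 z, f (ρ ^ 2 / w) * f w = k) : (eulerLogDeriv f z).im = 0 := by
  have hconj : (ρ : ℂ) ^ 2 / z = conj z := by rw [div_eq_iff hz, conj_mul', hρ]
  rw [← conj_eq_iff_im, ← eulerLogDeriv_conj hf, ← hconj]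
  exact eulerLogDeriv_div_eq hk hz hfz (hconj ▸ hfc) h

theorem deriv_eq_fderiv_prod_apply {g : ℝ × ℂ → ℂ} {p : ℝ × ℂ} (hg : DifferentiableAt ℝ g p)
    (hc : DifferentiableAt ℂ (fun z => g (p.1, z)) p.2) :
    deriv (fun z => g (p.1, z)) p.2 = fderiv ℝ g p (0, 1) := by
  have hpartial := HasFDerivAt.comp (g := g) p.2 hg.hasFDerivAt
    (hasFDerivAt_prodMk_right (𝕜 := ℝ) p.1 p.2)
  have heq := (hc.hasDerivAt.hasFDerivAt.restrictScalars ℝ).unique hpartial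
  simpa using DFunLike.congr_fun heq 1

theorem div_sub_ofReal_im_nonpos {x : ℝ} {z : ℂ} (hx : 0 ≤ x) (hz : 0 ≤ z.im) :
    (z / (z - x)).im ≤ 0 := by
  rw [div_im, sub_re, sub_im, ofReal_re, ofReal_im, sub_zero, ← sub_div]
  exact div_nonpos_of_nonpos_of_nonneg (by nlinarith) (normSq_nonneg _)

section CanonicalMap

variable {r x : ℝ} {z : ℂ} (hr : 0 < r) (hx : x ∈ Ioo r 1)

include hr hx

theorem analyticAt_thetaQuotient (hz : z ∈ annulus (r ^ 2 / x) (1 / x)) :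
    AnalyticAt ℂ (thetaQuotient r x) z :=
  (differentiableOn_thetaQuotient hr hx).analyticAt ((isOpen_annulus _ _).mem_nhds hz)

theorem analyticAt_eulerLogDeriv_thetaQuotient (hz : z ∈ annulus (r ^ 2 / x) (1 / x)) :
    AnalyticAt ℂ (eulerLogDeriv (thetaQuotient r x)) z :=
  analyticAt_eulerLogDeriv (analyticAt_thetaQuotient hr hx hz) (thetaQuotient_ne_zero hr hx hz)

theorem analyticAt_eulerLogDeriv_canonicalMap (hz : z ∈ annulus (r ^ 2 / x) (1 / x))
    (hzx : z ≠ x) : AnalyticAt ℂ (eulerLogDeriv (canonicalMap r x)) z :=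
  analyticAt_eulerLogDeriv (analyticAt_canonicalMap hr hx hz) (canonicalMap_ne_zero hr hx hz hzx)

theorem eulerLogDeriv_canonicalMap (hz : z ∈ annulus (r ^ 2 / x) (1 / x)) (hzx : z ≠ x) :
    eulerLogDeriv (canonicalMap r x) z = z / (z - x) + eulerLogDeriv (thetaQuotient r x) z := by
  have hmul := logDeriv_mul z (f := fun w : ℂ => w - x) (sub_ne_zero.2 hzx)
    (thetaQuotient_ne_zero hr hx hz) (by fun_prop)
    (analyticAt_thetaQuotient hr hx hz).differentiableAt
  have hsub : logDeriv (fun w : ℂ => w - x) z = 1 / (z - x) := by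
    rw [logDeriv_apply, deriv_sub_const, deriv_id'']
  change z * logDeriv (fun w => (w - x) * thetaQuotient r x w) z = _
  rw [hmul, hsub, mul_add, mul_one_div, eulerLogDeriv]

theorem eulerLogDeriv_canonicalMap_im_eq_zero_of_norm_eq (hz : ‖z‖ = r) :
    (eulerLogDeriv (canonicalMap r x) z).im = 0 := by
  have hsphere (w : ℂ) (hw : ‖w‖ = r) : w ∈ annulus (r ^ 2 / x) x :=
    sphere_subset_inner_annulus hr hx (mem_sphere_zero_iff_norm.2 hw)
  have hdiff (w : ℂ) (hw : ‖w‖ = r) : DifferentiableAt ℂ (canonicalMap r x) w :=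
    (analyticAt_canonicalMap hr hx (inner_annulus_subset hr hx (hsphere w hw))).differentiableAt
  refine eulerLogDeriv_im_eq_zero_of_reflection (canonicalMap_conj hr hx)
    (pow_ne_zero 2 (ofReal_ne_zero.2 (hr.trans hx.1).ne'))
    (norm_pos_iff.1 (hz ▸ hr)) hz (hdiff z hz) (hdiff _ ((norm_conj z).trans hz)) ?_
  filter_upwards [(isOpen_annulus _ _).mem_nhds (hsphere z hz)] with w hw
  exact canonicalMap_sq_div_mul hr hx hw

theorem eulerLogDeriv_canonicalMap_im_eq_zero_of_norm_eq_one (hz : ‖z‖ = 1) :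
    (eulerLogDeriv (canonicalMap r x) z).im = 0 := by
  have hsphere (w : ℂ) (hw : ‖w‖ = 1) : w ∈ annulus x (1 / x) :=
    sphere_subset_outer_annulus hr hx (mem_sphere_zero_iff_norm.2 hw)
  have hdiff (w : ℂ) (hw : ‖w‖ = 1) : DifferentiableAt ℂ (canonicalMap r x) w :=
    (analyticAt_canonicalMap hr hx (outer_annulus_subset hr hx (hsphere w hw))).differentiableAt
  refine eulerLogDeriv_im_eq_zero_of_reflection (canonicalMap_conj hr hx) one_ne_zero
    (norm_pos_iff.1 (by rw [hz]; exact one_pos)) hz (hdiff z hz)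
    (hdiff _ ((norm_conj z).trans hz)) ?_
  filter_upwards [(isOpen_annulus _ _).mem_nhds (hsphere z hz)] with w hw
  rw [ofReal_one, one_pow]
  exact canonicalMap_inv_mul hr hx hw

theorem eulerLogDeriv_canonicalMap_im_eq_zero_of_mem_frontier
    (hz : z ∈ frontier (upperHalfAnnulus r 1)) : (eulerLogDeriv (canonicalMap r x) z).im = 0 := by
  rcases mem_of_mem_frontier_upperHalfAnnulus hz with h | h | h
  · exact eulerLogDeriv_canonicalMap_im_eq_zero_of_norm_eq hr hx h
  · exact eulerLogDeriv_canonicalMap_im_eq_zero_of_norm_eq_one hr hx h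
  · exact eulerLogDeriv_im_eq_zero (canonicalMap_conj hr hx) h

theorem eventually_eulerLogDeriv_canonicalMap_im_lt {ζ : ℂ}
    (hζ : ζ ∈ frontier (upperHalfAnnulus r 1)) {ε : ℝ} (hε : 0 < ε) :
    ∀ᶠ w in 𝓝[upperHalfAnnulus r 1] ζ, (eulerLogDeriv (canonicalMap r x) w).im < ε := by
  have hmem : ζ ∈ annulus (r ^ 2 / x) (1 / x) :=
    closure_annulus_one_subset hr hx (closure_mono inter_subset_left hζ.1)
  rcases eq_or_ne ζ x with rfl | hne
  · have h₀ : (eulerLogDeriv (thetaQuotient r x) x).im = 0 :=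
      eulerLogDeriv_im_eq_zero (thetaQuotient_conj hr hx) (ofReal_im x)
    have hcont : ContinuousAt (fun w => (eulerLogDeriv (thetaQuotient r x) w).im) x :=
      continuous_im.continuousAt.comp
        (analyticAt_eulerLogDeriv_thetaQuotient hr hx hmem).continuousAt
    filter_upwards [nhdsWithin_le_nhds (hcont.eventually_lt_const (h₀ ▸ hε)),
      self_mem_nhdsWithin] with w hw ⟨hwA, hwi⟩
    rw [eulerLogDeriv_canonicalMap hr hx (annulus_one_subset hr hx hwA)
      (ne_ofReal_of_im_pos hwi x), add_im]
    linarith [div_sub_ofReal_im_nonpos (hr.trans hx.1).le hwi.le]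
  · have hcont : ContinuousAt (fun w => (eulerLogDeriv (canonicalMap r x) w).im) ζ :=
      continuous_im.continuousAt.comp
        (analyticAt_eulerLogDeriv_canonicalMap hr hx hmem hne).continuousAt
    have h₀ := eulerLogDeriv_canonicalMap_im_eq_zero_of_mem_frontier hr hx hζ
    exact nhdsWithin_le_nhds (hcont.eventually_lt_const (h₀.trans_lt hε))

theorem analyticOnNhd_eulerLogDeriv_canonicalMap :
    AnalyticOnNhd ℂ (eulerLogDeriv (canonicalMap r x)) (upperHalfAnnulus r 1) :=
  fun _ hz => analyticAt_eulerLogDeriv_canonicalMap hr hx (annulus_one_subset hr hx hz.1)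
    (ne_ofReal_of_im_pos hz.2 x)

theorem eulerLogDeriv_canonicalMap_im_nonpos (hz : z ∈ upperHalfAnnulus r 1) :
    (eulerLogDeriv (canonicalMap r x) z).im ≤ 0 := by
  have hu : IsLocallyHolomorphicNormOn
      (fun w => Real.exp (eulerLogDeriv (canonicalMap r x) w).im) (upperHalfAnnulus r 1) := by
    refine fun w hw => ⟨fun w => exp (-I * eulerLogDeriv (canonicalMap r x) w), ?_,
      .of_forall fun v => by simp [norm_exp]⟩
    filter_upwards [(isOpen_upperHalfAnnulus r 1).mem_nhds hw] with v hv
    exact ((analyticOnNhd_eulerLogDeriv_canonicalMap hr hx v hv).differentiableAt.const_mul _).cexp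
  rw [← Real.exp_le_one_iff]
  refine hu.le_of_frontier (isOpen_upperHalfAnnulus r 1)
    ((isBounded_annulus r 1).subset inter_subset_left) (fun ζ hζ c hc => ?_) hz
  filter_upwards [eventually_eulerLogDeriv_canonicalMap_im_lt hr hx hζ (Real.log_pos hc)] with w hw
  exact (Real.lt_log_iff_exp_lt (one_pos.trans hc)).1 hw

theorem not_eulerLogDeriv_canonicalMap_eq_const (c : ℂ) :
    ¬ ∀ z ∈ upperHalfAnnulus r 1, eulerLogDeriv (canonicalMap r x) z = c := by
  intro hconst
  have hxA := annulus_one_subset hr hx (ofReal_mem_annulus hr hx)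
  have hxU : (x : ℂ) ∈ closure (upperHalfAnnulus r 1) :=
    annulus_inter_im_nonneg_subset_closure r 1
      ⟨ofReal_mem_annulus hr hx, (ofReal_im x).ge⟩
  have heq : EqOn (fun z => z + (z - x) * eulerLogDeriv (thetaQuotient r x) z)
      (fun z => c * (z - x)) (upperHalfAnnulus r 1) := fun z hz => by
    have hzx := ne_ofReal_of_im_pos hz.2 x
    have := eulerLogDeriv_canonicalMap hr hx (annulus_one_subset hr hx hz.1) hzx
    rw [hconst z hz] at this
    have hne := sub_ne_zero.2 hzx
    simp only [this]
    field_simp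
  have hcont : ContinuousOn (fun z => z + (z - x) * eulerLogDeriv (thetaQuotient r x) z)
      (insert (x : ℂ) (upperHalfAnnulus r 1)) := fun z hz => by
    have hzA : z ∈ annulus (r ^ 2 / x) (1 / x) :=
      hz.elim (fun h => h ▸ hxA) fun h => annulus_one_subset hr hx h.1
    have := (analyticAt_eulerLogDeriv_thetaQuotient hr hx hzA).continuousAt
    exact (continuousAt_id.add ((continuousAt_id.sub continuousAt_const).mul
      this)).continuousWithinAt
  have hval := heq.of_subset_closure hcont (by fun_prop) (subset_insert _ _)
    (insert_subset hxU subset_closure) (mem_insert _ _)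
  have hx₀ : (x : ℂ) = 0 := by simpa using hval
  exact (hr.trans hx.1).ne' (ofReal_eq_zero.1 hx₀)

theorem eulerLogDeriv_canonicalMap_im_neg (hz : z ∈ upperHalfAnnulus r 1) :
    (eulerLogDeriv (canonicalMap r x) z).im < 0 := by
  rcases (analyticOnNhd_eulerLogDeriv_canonicalMap hr hx).is_constant_or_isOpen
    (isPreconnected_upperHalfAnnulus hr one_pos) with ⟨c, hc⟩ | hopen
  · exact absurd hc (not_eulerLogDeriv_canonicalMap_eq_const hr hx c)
  · have hsub : eulerLogDeriv (canonicalMap r x) '' upperHalfAnnulus r 1 ⊆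
        interior {w | w.im ≤ 0} :=
      (hopen _ Subset.rfl (isOpen_upperHalfAnnulus r 1)).subset_interior_iff.2
        (image_subset_iff.2 fun w hw => eulerLogDeriv_canonicalMap_im_nonpos hr hx hw)
    rw [Complex.interior_setOfPred_im_le] at hsub
    exact hsub (mem_image_of_mem _ hz)

theorem eventually_mem_annulus (hz : z ∈ annulus (r ^ 2 / x) (1 / x)) :
    ∀ᶠ p : ℝ × ℂ in 𝓝 (x, z), p.1 ∈ Ioo r 1 ∧ p.2 ∈ annulus (r ^ 2 / p.1) (1 / p.1) := by
  have hx₀ : x ≠ 0 := (hr.trans hx.1).ne'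
  have hinner : ContinuousAt (fun p : ℝ × ℂ => r ^ 2 / p.1) (x, z) :=
    continuousAt_const.div continuousAt_fst hx₀
  have houter : ContinuousAt (fun p : ℝ × ℂ => 1 / p.1) (x, z) :=
    continuousAt_const.div continuousAt_fst hx₀
  have hnorm : ContinuousAt (fun p : ℝ × ℂ => ‖p.2‖) (x, z) := continuousAt_snd.norm
  exact (continuousAt_fst.eventually (isOpen_Ioo.mem_nhds hx)).and
    ((hinner.eventually_lt hnorm hz.1).and (hnorm.eventually_lt houter hz.2))

theorem contDiffAt_eulerLogDeriv_canonicalMap (hz : z ∈ annulus (r ^ 2 / x) (1 / x))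
    (hzx : z ≠ x) :
    ContDiffAt ℝ ∞ (fun p : ℝ × ℂ => eulerLogDeriv (canonicalMap r p.1) p.2) (x, z) := by
  have hf := contDiffAt_canonicalMap hr hx hz
  have hderiv : ContDiffAt ℝ ∞ (fun p : ℝ × ℂ =>
      fderiv ℝ (fun p : ℝ × ℂ => canonicalMap r p.1 p.2) p (0, 1)) (x, z) :=
    (hf.fderiv_right (m := ∞) (by simp)).clm_apply contDiffAt_const
  have hfz := canonicalMap_ne_zero hr hx hz hzx
  refine (contDiffAt_snd.mul (hderiv.mul (hf.inv hfz))).congr_of_eventuallyEq ?_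
  filter_upwards [eventually_mem_annulus hr hx hz] with p ⟨hp₁, hp₂⟩
  rw [← deriv_eq_fderiv_prod_apply
    ((contDiffAt_canonicalMap hr hp₁ hp₂).differentiableAt (by simp))
    (analyticAt_canonicalMap hr hp₁ hp₂).differentiableAt]
  rfl

end CanonicalMap

theorem eq_of_mem_closure_of_map_eq {X Y : Type*} [TopologicalSpace X] [T2Space X]
    [TopologicalSpace Y] {f : X → Y} {A S : Set X} {a b : X} (hA : IsOpen A)
    (hopen : ∀ s ⊆ A, IsOpen s → IsOpen (f '' s)) (hinj : ∀ a ∈ A, ∀ s ∈ S, f a = f s → a = s)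
    (ha : a ∈ A) (hb : b ∈ closure S) (hf : ContinuousAt f b) (hab : f a = f b) : a = b := by
  by_contra hne
  obtain ⟨U, V, hU, hV, haU, hbV, hUV⟩ := t2_separation hne
  have hnear : f '' (U ∩ A) ∈ 𝓝 (f b) :=
    (hopen _ inter_subset_right (hU.inter hA)).mem_nhds (hab ▸ mem_image_of_mem f ⟨haU, ha⟩)
  obtain ⟨s, ⟨⟨c, ⟨hcU, hcA⟩, hcs⟩, hsV⟩, hsS⟩ :=
    mem_closure_iff_nhds.1 hb _ (inter_mem (hf hnear) (hV.mem_nhds hbV))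
  exact hUV.le_bot ⟨hcU, hinj c hcA s hsS hcs ▸ hsV⟩

section CanonicalMap

variable {r x : ℝ} {z : ℂ} (hr : 0 < r) (hx : x ∈ Ioo r 1)

include hr hx

/- The Noshiro–Warschawski criterion, applied to `log ∘ f ∘ exp`. -/
theorem injOn_canonicalMap_upperHalfAnnulus :
    InjOn (canonicalMap r x) (upperHalfAnnulus r 1) := by
  set R := Ioo (Real.log r) (Real.log 1) ×ℂ Ioo 0 π
  have himage : exp '' R = upperHalfAnnulus r 1 := image_exp_reProdIm hr one_pos
  have hexp (w : ℂ) (hw : w ∈ R) : exp w ∈ upperHalfAnnulus r 1 :=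
    himage ▸ mem_image_of_mem exp hw
  have hderiv (w : ℂ) (hw : w ∈ R) : HasDerivAt (fun w => log (canonicalMap r x (exp w)))
      (eulerLogDeriv (canonicalMap r x) (exp w)) w := by
    have hmem := annulus_one_subset hr hx (hexp w hw).1
    exact hasDerivAt_log_comp_exp (analyticAt_canonicalMap hr hx hmem).differentiableAt
      (.inr (canonicalMap_im_pos hr hx hmem (hexp w hw).2).ne')
  have hinj := injOn_of_deriv_im_neg (convex_reProdIm (convex_Ioo _ _) (convex_Ioo _ _)) hderiv
    fun w hw => eulerLogDeriv_canonicalMap_im_neg hr hx (hexp w hw)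
  rw [← himage]
  rintro - ⟨w₁, hw₁, rfl⟩ - ⟨w₂, hw₂, rfl⟩ heq
  rw [hinj hw₁ hw₂ (congrArg log heq)]

theorem im_pos_of_canonicalMap_im_pos (hz : z ∈ annulus (r ^ 2 / x) (1 / x))
    (him : 0 < (canonicalMap r x z).im) : 0 < z.im := by
  rwa [← sign_eq_one_iff, ← sign_canonicalMap_im hr hx hz, sign_eq_one_iff]

theorem eq_of_canonicalMap_eq_of_im_nonneg {a b : ℂ} (ha : a ∈ annulus r 1)
    (hb : b ∈ annulus r 1) (hbi : 0 ≤ b.im) (hab : canonicalMap r x a = canonicalMap r x b) :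
    a = b := by
  have hsub := annulus_one_subset hr hx
  refine eq_of_mem_closure_of_map_eq (isOpen_annulus r 1)
    (fun s hs => isOpen_image_canonicalMap hr hx (hs.trans hsub)) (S := upperHalfAnnulus r 1)
    (fun a ha s hs has => ?_) ha
    (annulus_inter_im_nonneg_subset_closure r 1 ⟨hb, hbi⟩)
    (analyticAt_canonicalMap hr hx (hsub hb)).continuousAt hab
  have hai := im_pos_of_canonicalMap_im_pos hr hx (hsub ha)
    (has ▸ canonicalMap_im_pos hr hx (hsub hs.1) hs.2)
  exact injOn_canonicalMap_upperHalfAnnulus hr hx ⟨ha, hai⟩ hs has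

theorem injOn_canonicalMap : InjOn (canonicalMap r x) (annulus r 1) := by
  intro a ha b hb hab
  rcases le_total 0 b.im with hbi | hbi
  · exact eq_of_canonicalMap_eq_of_im_nonneg hr hx ha hb hbi hab
  · refine (starRingEnd ℂ).injective (eq_of_canonicalMap_eq_of_im_nonneg hr hx (conj_mem_annulus ha)
      (conj_mem_annulus hb) (by rw [conj_im]; linarith) ?_)
    rw [canonicalMap_conj hr hx, canonicalMap_conj hr hx, hab]

theorem disjoint_canonicalMap_image_sphere :
    Disjoint (canonicalMap r x '' annulus r 1) (canonicalMap r x '' sphere 0 r) := by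
  rw [disjoint_left]
  rintro - ⟨a, ha, rfl⟩ ⟨b, hb, hab⟩
  have hb' := sphere_subset_inner_annulus hr hx hb
  have hne : a = b := eq_of_mem_closure_of_map_eq (isOpen_annulus r 1)
    (fun s hs => isOpen_image_canonicalMap hr hx (hs.trans (annulus_one_subset hr hx)))
    (fun a ha s hs => injOn_canonicalMap hr hx ha hs) ha
    (sphere_subset_closure_annulus hr (hx.1.trans hx.2) hb)
    (analyticAt_canonicalMap hr hx (inner_annulus_subset hr hx hb')).continuousAt hab.symm
  exact ha.1.ne' (by rw [hne, mem_sphere_zero_iff_norm.1 hb])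

end CanonicalMap

/-! ### Circular arcs and the slit -/

theorem circularArc_subset_sphere {ρ : ℝ} (hρ : 0 ≤ ρ) (a b : ℝ) :
    circularArc ρ a b ⊆ sphere 0 ρ := by
  rintro - ⟨θ, -, rfl⟩
  rw [mem_sphere_zero_iff_norm, norm_mul_exp_ofReal_mul_I hρ]

theorem circularArc_subset_circularArc_add (ρ a b : ℝ) (n : ℤ) :
    circularArc ρ a b ⊆ circularArc ρ (a + 2 * π * n) (b + 2 * π * n) := by
  rintro - ⟨θ, hθ, rfl⟩
  refine ⟨θ + 2 * π * n, ⟨by linarith [hθ.1], by linarith [hθ.2]⟩, ?_⟩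
  have hperiod := exp_periodic.int_mul n (θ * I)
  push_cast
  rw [← hperiod]
  ring_nf

theorem circularArc_add_int (ρ a b : ℝ) (n : ℤ) :
    circularArc ρ (a + 2 * π * n) (b + 2 * π * n) = circularArc ρ a b := by
  refine (subset_antisymm (circularArc_subset_circularArc_add ρ a b n) ?_).symm
  have hcancel (c : ℝ) : c + 2 * π * n + 2 * π * (-n : ℤ) = c := by push_cast; ring
  simpa only [hcancel] using
    circularArc_subset_circularArc_add ρ (a + 2 * π * n) (b + 2 * π * n) (-n)

theorem mul_exp_mem_circularArc_iff {ρ : ℝ} (hρ : ρ ≠ 0) {θ a b : ℝ} :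
    ρ * exp (θ * I) ∈ circularArc ρ a b ↔ ∃ n : ℤ, θ + 2 * π * n ∈ Icc a b := by
  constructor
  · rintro ⟨t, ht, heq⟩
    obtain ⟨n, hn⟩ := exp_eq_exp_iff_exists_int.1 (mul_left_cancel₀ (ofReal_ne_zero.2 hρ) heq)
    refine ⟨n, ?_⟩
    have : (t : ℂ) = (θ + 2 * π * n : ℝ) := by
      push_cast
      apply mul_right_cancel₀ I_ne_zero
      rw [hn]
      ring
    rwa [← ofReal_injective this]
  · rintro ⟨n, hn⟩
    rw [← circularArc_add_int ρ a b (-n)]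
    refine ⟨θ, ⟨?_, ?_⟩, rfl⟩ <;> push_cast <;> linarith [hn.1, hn.2]

theorem mul_exp_mem_circularArc_iff_le {ρ : ℝ} (hρ : ρ ≠ 0) {θ a b : ℝ} (ha : a ≤ θ)
    (hθ : θ < a + 2 * π) :
    ρ * exp (θ * I) ∈ circularArc ρ a b ↔ θ ≤ b := by
  refine (mul_exp_mem_circularArc_iff hρ).trans ⟨?_, fun h => ⟨0, by simpa using ⟨ha, h⟩⟩⟩
  rintro ⟨n, hn₁, hn₂⟩
  have hn : 0 ≤ n := by
    have : (-1 : ℝ) < n := by nlinarith [Real.pi_pos]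
    exact_mod_cast Int.lt_iff_add_one_le.1 (by exact_mod_cast this : (-1 : ℤ) < n)
  have : (0 : ℝ) ≤ n := by exact_mod_cast hn
  nlinarith [Real.pi_pos]

theorem eq_of_circularArc_eq_of_mem_Icc {ρ a b a' b' : ℝ} (hρ : ρ ≠ 0) (hb : b < a + 2 * π)
    (hab' : a' < b') (hb' : b' < a' + 2 * π) (h : circularArc ρ a b = circularArc ρ a' b')
    (ha' : a' ∈ Icc a b) : a' = a ∧ b' = b := by
  have haa : a' = a := by
    refine ha'.1.antisymm' (not_lt.1 fun hlt => ?_)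
    obtain ⟨t, ht, hta⟩ := exists_between (max_lt hlt (sub_lt_iff_lt_add.2 hb'))
    have hmem : ρ * exp ((t + 2 * π : ℝ) * I) ∈ circularArc ρ a' b' := by
      rw [← h]
      exact (mul_exp_mem_circularArc_iff hρ).2
        ⟨-1, by push_cast; linarith [le_max_left a (b' - 2 * π)], by push_cast; linarith [ha'.2]⟩
    rw [mul_exp_mem_circularArc_iff_le hρ (by linarith [le_max_left a (b' - 2 * π), ha'.2])
      (by linarith)] at hmem
    linarith [le_max_right a (b' - 2 * π)]
  subst haa
  have hmem {c : ℝ} (hc : a' ≤ c) (hc' : c < a' + 2 * π) : c ≤ b ↔ c ≤ b' := by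
    rw [← mul_exp_mem_circularArc_iff_le hρ hc hc', h,
      mul_exp_mem_circularArc_iff_le hρ hc hc']
  exact ⟨rfl, ((hmem hab'.le hb').2 le_rfl).antisymm ((hmem ha'.2 hb).1 le_rfl)⟩

theorem circularArc_inj {ρ ρ' a b a' b' : ℝ} (hρ : 0 < ρ) (hb : b < a + 2 * π)
    (hρ' : 0 < ρ') (hab' : a' < b') (hb' : b' < a' + 2 * π)
    (h : circularArc ρ a b = circularArc ρ' a' b') :
    ρ = ρ' ∧ ∃ n : ℤ, a' + 2 * π * n = a ∧ b' + 2 * π * n = b := by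
  have hmem : ρ' * exp (a' * I) ∈ circularArc ρ a b := h ▸ ⟨a', left_mem_Icc.2 hab'.le, rfl⟩
  have hρρ : ρ = ρ' := by
    have := mem_sphere_zero_iff_norm.1 (circularArc_subset_sphere hρ.le a b hmem)
    rwa [norm_mul_exp_ofReal_mul_I hρ'.le, eq_comm] at this
  subst hρρ
  obtain ⟨n, hn⟩ := (mul_exp_mem_circularArc_iff hρ.ne').1 hmem
  exact ⟨rfl, n, eq_of_circularArc_eq_of_mem_Icc hρ.ne' hb (by linarith) (by linarith)
    (by rw [h, circularArc_add_int]) hn⟩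

theorem isArcEndpoint_circularArc_iff {ρ a b : ℝ} (hρ : 0 < ρ) (hab : a < b)
    (hb : b < a + 2 * π) {w : ℂ} : IsArcEndpoint (circularArc ρ a b) w ↔
      w = ρ * exp (a * I) ∨ w = ρ * exp (b * I) := by
  refine ⟨?_, fun h => ⟨ρ, a, b, hρ, hab, hb, rfl, h⟩⟩
  rintro ⟨ρ', a', b', hρ', hab', hb', heq, hw⟩
  obtain ⟨rfl, n, rfl, rfl⟩ := circularArc_inj hρ hb hρ' hab' hb' heq
  have hexp (θ : ℝ) : exp ((θ + 2 * π * n : ℝ) * I) = exp (θ * I) := by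
    rw [← exp_periodic.int_mul n (θ * I)]
    push_cast
    ring_nf
  rwa [hexp, hexp]

theorem mul_exp_ofReal_mul_I_im (ρ θ : ℝ) : (ρ * exp (θ * I)).im = ρ * Real.sin θ := by
  rw [im_ofReal_mul, exp_ofReal_mul_I_im]

theorem isArcEndpoint_circularArc_and_im_pos_iff {ρ m : ℝ} (hρ : 0 < ρ) (hm : m ∈ Ioo 0 π)
    {w : ℂ} : IsArcEndpoint (circularArc ρ m (2 * π - m)) w ∧ 0 < w.im ↔
      w = ρ * exp (m * I) := by
  have hsin := Real.sin_pos_of_mem_Ioo hm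
  rw [isArcEndpoint_circularArc_iff hρ (by linarith [hm.2]) (by linarith [hm.1])]
  constructor
  · rintro ⟨rfl | rfl, him⟩
    · rfl
    · rw [mul_exp_ofReal_mul_I_im, Real.sin_two_pi_sub] at him
      nlinarith
  · rintro rfl
    exact ⟨.inl rfl, by rw [mul_exp_ofReal_mul_I_im]; positivity⟩

theorem circularArc_inter_im_eq_zero {ρ m : ℝ} (hρ : 0 < ρ) (hm : m ∈ Ioo 0 π) :
    circularArc ρ m (2 * π - m) ∩ {w | w.im = 0} = {(-ρ : ℂ)} := by
  ext w
  constructor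
  · rintro ⟨⟨θ, hθ, rfl⟩, him : (_ : ℂ).im = 0⟩
    have hsin : Real.sin (θ - π) = 0 := by
      rw [Real.sin_sub_pi, neg_eq_zero]
      simpa [mul_exp_ofReal_mul_I_im, hρ.ne'] using him
    have hπ := (Real.sin_eq_zero_iff_of_lt_of_lt (by linarith [hm.1, hθ.1])
      (by linarith [hm.1, hθ.2])).1 hsin
    rw [sub_eq_zero.1 hπ]
    simp
  · rintro rfl
    exact ⟨⟨π, ⟨hm.2.le, by linarith [hm.2]⟩, by simp⟩, by simp⟩

theorem neg_mem_slitPlane_of_norm_eq {w : ℂ} {ρ : ℝ} (hw : ‖w‖ = ρ) (hne : w ≠ ρ) :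
    -w ∈ slitPlane := by
  by_contra hslit
  simp only [mem_slitPlane_iff, neg_re, neg_im, not_or, not_lt, not_not, neg_eq_zero,
    neg_nonpos] at hslit
  have hw' : w = (w.re : ℂ) := Complex.ext rfl hslit.2
  rw [hw', Complex.norm_of_nonneg hslit.1] at hw
  exact hne (hw ▸ hw')

theorem neg_norm_mul_exp_arg_neg_add_pi (w : ℂ) :
    ‖w‖ * exp ((arg (-w) + π : ℝ) * I) = w := by
  have h := norm_mul_exp_arg_mul_I (-w)
  rw [norm_neg] at h
  rw [ofReal_add, add_mul, exp_add, exp_pi_mul_I, mul_neg_one, mul_neg, h, neg_neg]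

theorem arg_neg_conj_of_neg_mem_slitPlane {w : ℂ} (hw : -w ∈ slitPlane) :
    arg (-conj w) = -arg (-w) := by
  rw [← map_neg, arg_conj, if_neg (mem_slitPlane_iff_arg.1 hw).1]

theorem exists_eq_circularArc_of_isCompact {Γ : Set ℂ} {ρ : ℝ} (hΓ : Γ ⊆ sphere 0 ρ)
    (hc : IsCompact Γ) (hconn : IsPreconnected Γ) (hconj : ∀ w ∈ Γ, conj w ∈ Γ)
    (hρΓ : (ρ : ℂ) ∉ Γ) (him : ∃ w ∈ Γ, w.im ≠ 0) :
    ∃ m ∈ Ioo 0 π, Γ = circularArc ρ m (2 * π - m) := by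
  have hslit (w : ℂ) (hw : w ∈ Γ) : -w ∈ slitPlane :=
    neg_mem_slitPlane_of_norm_eq (mem_sphere_zero_iff_norm.1 (hΓ hw)) fun h => hρΓ (h ▸ hw)
  have hcont : ContinuousOn (fun w => arg (-w)) Γ := fun w hw =>
    ((continuousAt_arg (hslit w hw)).comp continuousAt_neg).continuousWithinAt
  have hodd (w : ℂ) (hw : w ∈ Γ) : arg (-conj w) = -arg (-w) :=
    arg_neg_conj_of_neg_mem_slitPlane (hslit w hw)
  obtain ⟨v, hv, hvi⟩ := him
  obtain ⟨w₀, hw₀, hmin⟩ := hc.exists_isMinOn ⟨v, hv⟩ hcont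
  have hneg : arg (-w₀) < 0 := by
    have hle : arg (-w₀) ≤ arg (-v) := hmin hv
    have hle' : arg (-w₀) ≤ -arg (-v) := hodd v hv ▸ hmin (hconj v hv)
    have hv₀ : arg (-v) ≠ 0 := fun h => hvi (by simpa using (arg_eq_zero_iff.1 h).2)
    rcases hv₀.lt_or_gt with h | h <;> linarith
  refine ⟨arg (-w₀) + π, ⟨by linarith [neg_pi_lt_arg (-w₀)], by linarith⟩, ?_⟩
  ext w
  constructor
  · intro hw
    have hle : arg (-w₀) ≤ arg (-w) := hmin hw
    have hle' : arg (-w₀) ≤ -arg (-w) := hodd w hw ▸ hmin (hconj w hw)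
    refine ⟨arg (-w) + π, ⟨by linarith, by linarith⟩, ?_⟩
    rw [← mem_sphere_zero_iff_norm.1 (hΓ hw)]
    exact neg_norm_mul_exp_arg_neg_add_pi w
  · rintro ⟨θ, hθ, rfl⟩
    have hIcc := (hconn.image _ hcont).Icc_subset (mem_image_of_mem _ hw₀)
      (mem_image_of_mem _ (hconj w₀ hw₀))
    obtain ⟨w, hw, hwθ⟩ : θ - π ∈ (fun w => arg (-w)) '' Γ :=
      hIcc ⟨by linarith [hθ.1], by rw [hodd w₀ hw₀]; linarith [hθ.2]⟩
    have hwρ := mem_sphere_zero_iff_norm.1 (hΓ hw)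
    have := neg_norm_mul_exp_arg_neg_add_pi w
    have hwarg : arg (-w) + π = θ := sub_eq_iff_eq_add.1 hwθ.symm |>.symm
    rw [hwarg, hwρ] at this
    change ρ * exp (θ * I) ∈ Γ
    rwa [this]

section CanonicalMap

variable {r x : ℝ} {z : ℂ} (hr : 0 < r) (hx : x ∈ Ioo r 1)

include hr hx

theorem canonicalMap_image_sphere_subset : canonicalMap r x '' sphere 0 r ⊆ sphere 0 x := by
  rintro - ⟨z, hz, rfl⟩
  rw [mem_sphere_zero_iff_norm] at hz ⊢
  exact norm_canonicalMap_of_norm_eq hr hx hz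

theorem ofReal_notMem_canonicalMap_image_sphere : (x : ℂ) ∉ canonicalMap r x '' sphere 0 r := by
  rintro ⟨z, hz, heq⟩
  have hmem := inner_annulus_subset hr hx (sphere_subset_inner_annulus hr hx hz)
  have hzi : z.im = 0 := by
    rw [← sign_eq_zero_iff, ← sign_canonicalMap_im hr hx hmem, heq, ofReal_im, sign_zero]
  rw [canonicalMap_eq_neg_of_norm_eq_of_im_eq_zero hr hx (mem_sphere_zero_iff_norm.1 hz) hzi,
    neg_eq_self, ofReal_eq_zero] at heq
  exact (hr.trans hx.1).ne' heq

theorem closure_canonicalMap_image_inter_subset :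
    closure (canonicalMap r x '' annulus r 1) ∩ (ball 0 1 \ canonicalMap r x '' sphere 0 r) ⊆
      canonicalMap r x '' annulus r 1 := by
  have hcont : ContinuousOn (canonicalMap r x) (closure (annulus r 1)) :=
    (differentiableOn_canonicalMap hr hx).continuousOn.mono (closure_annulus_one_subset hr hx)
  rw [← image_closure_of_isCompact (isBounded_annulus r 1).isCompact_closure hcont]
  rintro - ⟨⟨z, hz, rfl⟩, hball, hsphere⟩
  obtain ⟨hrz, hz₁⟩ := closure_annulus_subset r 1 hz
  refine mem_image_of_mem _ ⟨hrz.lt_of_ne ?_, hz₁.lt_of_ne ?_⟩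
  · exact fun h => hsphere (mem_image_of_mem _ (mem_sphere_zero_iff_norm.2 h.symm))
  · exact fun h => (mem_ball_zero_iff.1 hball).ne (norm_canonicalMap_of_norm_eq_one hr hx h)

theorem slit_canonicalMap : slit r (canonicalMap r x) = canonicalMap r x '' sphere 0 r := by
  have hx₀ := hr.trans hx.1
  have hsub : canonicalMap r x '' annulus r 1 ⊆ ball 0 1 \ canonicalMap r x '' sphere 0 r :=
    subset_sdiff.2 ⟨image_subset_iff.2 fun z hz =>
      mem_ball_zero_iff.2 (norm_canonicalMap_lt_one hr hx hz),
      disjoint_canonicalMap_image_sphere hr hx⟩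
  have hpre : IsPreconnected (ball 0 1 \ canonicalMap r x '' sphere 0 r) :=
    isPreconnected_ball_diff (canonicalMap_image_sphere_subset hr hx) hx₀ hx.2
      (mem_sphere_zero_iff_norm.2 (Complex.norm_of_nonneg hx₀.le))
      (ofReal_notMem_canonicalMap_image_sphere hr hx)
  have hne : (canonicalMap r x '' annulus r 1).Nonempty :=
    ⟨_, mem_image_of_mem _ (ofReal_mem_annulus hr hx)⟩
  have himage : ball 0 1 \ canonicalMap r x '' sphere 0 r = canonicalMap r x '' annulus r 1 :=
    (hpre.subset_of_closure_inter_subset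
      (isOpen_image_canonicalMap hr hx (annulus_one_subset hr hx) (isOpen_annulus r 1))
      (by rwa [inter_eq_right.2 hsub])
      (closure_canonicalMap_image_inter_subset hr hx)).antisymm hsub
  rw [slit, ← himage, sdiff_sdiff_eq_self
    ((canonicalMap_image_sphere_subset hr hx).trans (sphere_subset_ball hx.2))]

theorem conj_mem_canonicalMap_image_sphere {w : ℂ} (hw : w ∈ canonicalMap r x '' sphere 0 r) :
    conj w ∈ canonicalMap r x '' sphere 0 r := by
  obtain ⟨z, hz, rfl⟩ := hw
  refine ⟨conj z, ?_, canonicalMap_conj hr hx z⟩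
  rwa [mem_sphere_zero_iff_norm, norm_conj, ← mem_sphere_zero_iff_norm]

theorem exists_slit_canonicalMap_eq :
    ∃ m ∈ Ioo 0 π, slit r (canonicalMap r x) = circularArc x m (2 * π - m) := by
  have hsphere : sphere 0 r ⊆ annulus (r ^ 2 / x) (1 / x) :=
    (sphere_subset_inner_annulus hr hx).trans (inner_annulus_subset hr hx)
  have hcont : ContinuousOn (canonicalMap r x) (sphere 0 r) :=
    (differentiableOn_canonicalMap hr hx).continuousOn.mono hsphere
  rw [slit_canonicalMap hr hx]
  refine exists_eq_circularArc_of_isCompact (canonicalMap_image_sphere_subset hr hx)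
    ((isCompact_sphere 0 r).image_of_continuousOn hcont)
    ((isPreconnected_sphere (by simp) 0 r).image _ hcont)
    (fun _ => conj_mem_canonicalMap_image_sphere hr hx)
    (ofReal_notMem_canonicalMap_image_sphere hr hx) ?_
  have hI : r * I ∈ sphere (0 : ℂ) r := by simp [hr.le]
  exact ⟨_, mem_image_of_mem _ hI, (canonicalMap_im_pos hr hx (hsphere hI) (by simpa)).ne'⟩

theorem isCanonicalMap_canonicalMap : IsCanonicalMap r x (canonicalMap r x) where
  holo := (differentiableOn_canonicalMap hr hx).mono (annulus_one_subset hr hx)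
  inj := injOn_canonicalMap hr hx
  mapsTo z hz := mem_ball_zero_iff.2 (norm_canonicalMap_lt_one hr hx hz)
  map_zero := canonicalMap_self r x
  circle_to_circle ζ hζ w hw := by
    have hmem := outer_annulus_subset hr hx (sphere_subset_outer_annulus hr hx hζ)
    have hlim := ((analyticAt_canonicalMap hr hx hmem).continuousAt.tendsto.mono_left
      (nhdsWithin_le_nhds (s := annulus r 1)))
    rw [eq_of_nhds_neBot (hw.neBot.mono (inf_le_inf_left _ hlim)), mem_sphere_zero_iff_norm]
    exact norm_canonicalMap_of_norm_eq_one hr hx (mem_sphere_zero_iff_norm.1 hζ)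
  arc := by
    obtain ⟨m, hm, heq⟩ := exists_slit_canonicalMap_eq hr hx
    exact ⟨x, m, 2 * π - m, hr.trans hx.1, by linarith [hm.2], by linarith [hm.1], heq⟩
  symm := by
    rw [slit_canonicalMap hr hx]
    exact fun _ => conj_mem_canonicalMap_image_sphere hr hx
  meets := by
    have hz : ((-r : ℝ) : ℂ) ∈ sphere (0 : ℂ) r := by simp [hr.le]
    refine ⟨-x, by linarith [hx.2], by linarith [hr.trans hx.1], ?_⟩
    rw [slit_canonicalMap hr hx]
    refine ⟨_, hz, ?_⟩
    rw [canonicalMap_eq_neg_of_norm_eq_of_im_eq_zero hr hx (mem_sphere_zero_iff_norm.1 hz)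
      (ofReal_im _), ofReal_neg]

end CanonicalMap

/-! ### The endpoint of the slit -/

theorem ofReal_mul_exp_mul_I_eq_exp {ρ : ℝ} (hρ : 0 < ρ) (θ : ℝ) :
    ρ * exp (θ * I) = exp (Real.log ρ + θ * I) := by
  rw [exp_add, ← ofReal_exp, Real.exp_log hρ]

theorem hasDerivAt_comp_add_ofReal_mul_I {g : ℂ → ℂ} {g' c : ℂ} {θ : ℝ}
    (hg : HasDerivAt g g' (c + θ * I)) : HasDerivAt (fun t : ℝ => g (c + t * I)) (g' * I) θ := by
  have hline : HasDerivAt (fun w : ℂ => c + w * I) I (θ : ℂ) := by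
    simpa using ((hasDerivAt_id (θ : ℂ)).mul_const I).const_add c
  exact (HasDerivAt.comp (θ : ℂ) hg hline).comp_ofReal

theorem eulerLogDeriv_neg (f : ℂ → ℂ) (z : ℂ) :
    eulerLogDeriv (fun z => -f z) z = eulerLogDeriv f z := by
  simp only [eulerLogDeriv, logDeriv_apply, deriv.fun_neg, neg_div_neg_eq]

theorem eulerLogDeriv_re_eq_zero_of_isLocalMin_arg {f : ℂ → ℂ} {ρ θ : ℝ} (hρ : 0 < ρ)
    (hf : DifferentiableAt ℂ f (ρ * exp (θ * I))) (hslit : f (ρ * exp (θ * I)) ∈ slitPlane)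
    (hmin : IsLocalMin (fun t : ℝ => arg (f (ρ * exp (t * I)))) θ) :
    (eulerLogDeriv f (ρ * exp (θ * I))).re = 0 := by
  simp only [ofReal_mul_exp_mul_I_eq_exp hρ] at hf hslit hmin ⊢
  have hlog := hasDerivAt_comp_add_ofReal_mul_I (hasDerivAt_log_comp_exp hf hslit)
  have harg := imCLM.hasFDerivAt.comp_hasDerivAt θ hlog
  simp only [imCLM_apply, Function.comp_def, log_im, mul_I_im] at harg
  exact hmin.hasDerivAt_eq_zero harg

theorem arg_neg_mul_exp {ρ s : ℝ} (hρ : 0 < ρ) (hs : s ∈ Ioc 0 (2 * π)) :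
    arg (-(ρ * exp (s * I))) = s - π := by
  have hexp : -(ρ * exp (s * I)) = ρ * exp ((s - π : ℝ) * I) := by
    rw [ofReal_sub, sub_mul, exp_sub, exp_pi_mul_I]
    ring
  rw [hexp, exp_mul_I, arg_mul_cos_add_sin_mul_I hρ ⟨by linarith [hs.1], by linarith [hs.2]⟩]

theorem contDiff_prodMk_mul_exp (ρ : ℝ) :
    ContDiff ℝ ∞ fun p : ℝ × ℝ => (p.1, (ρ * exp (p.2 * I) : ℂ)) :=
  contDiff_fst.prodMk (contDiff_const.mul
    ((ofRealCLM.contDiff.comp contDiff_snd).mul contDiff_const).cexp)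

section CanonicalMap

variable {r x θ : ℝ} (hr : 0 < r) (hx : x ∈ Ioo r 1)

include hr

theorem mul_exp_mem_sphere (θ : ℝ) : r * exp (θ * I) ∈ sphere (0 : ℂ) r := by
  rw [mem_sphere_zero_iff_norm, norm_mul_exp_ofReal_mul_I hr.le]

include hx

theorem mul_exp_mem_annulus (θ : ℝ) : r * exp (θ * I) ∈ annulus (r ^ 2 / x) (1 / x) :=
  inner_annulus_subset hr hx (sphere_subset_inner_annulus hr hx (mul_exp_mem_sphere hr θ))

theorem mul_exp_ne (θ : ℝ) : r * exp (θ * I) ≠ (x : ℂ) := by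
  intro h
  have := mem_sphere_zero_iff_norm.1 (mul_exp_mem_sphere hr θ)
  rw [h, Complex.norm_of_nonneg (hr.trans hx.1).le] at this
  exact hx.1.ne' this

theorem analyticAt_eulerLogDeriv_canonicalMap_comp_exp (θ : ℝ) :
    AnalyticAt ℂ (fun w => eulerLogDeriv (canonicalMap r x) (exp w)) (Real.log r + θ * I) := by
  refine AnalyticAt.comp (g := eulerLogDeriv (canonicalMap r x)) ?_ analyticAt_cexp
  rw [← ofReal_mul_exp_mul_I_eq_exp hr]
  exact analyticAt_eulerLogDeriv_canonicalMap hr hx (mul_exp_mem_annulus hr hx θ)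
    (mul_exp_ne hr hx θ)

theorem deriv_eulerLogDeriv_canonicalMap_comp_exp_im_neg (hθ : θ ∈ Ioo 0 π) :
    (deriv (fun w => eulerLogDeriv (canonicalMap r x) (exp w)) (Real.log r + θ * I)).im < 0 := by
  set w₀ : ℂ := Real.log r + θ * I with hw₀
  have hre : w₀.re = Real.log r := by simp [hw₀]
  have him : w₀.im = θ := by simp [hw₀]
  have hre₁ : w₀.re < Real.log 1 := hre ▸ Real.log_lt_log hr (hx.1.trans hx.2)
  refine im_deriv_neg_of_im_neg_of_im_eq_zero
    (analyticAt_eulerLogDeriv_canonicalMap_comp_exp hr hx θ) ?_ (.of_forall fun w hw => ?_)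
  · filter_upwards [continuous_re.continuousAt.eventually_lt_const hre₁,
      continuous_im.continuousAt.eventually (isOpen_Ioo.mem_nhds (him.symm ▸ hθ))]
      with w hw₁ hwi hw
    refine eulerLogDeriv_canonicalMap_im_neg hr hx ?_
    rw [← image_exp_reProdIm hr one_pos]
    exact mem_image_of_mem _ ⟨⟨hre ▸ hw, hw₁⟩, hwi⟩
  · refine eulerLogDeriv_canonicalMap_im_eq_zero_of_norm_eq hr hx ?_
    rw [norm_exp, hw, hre, Real.exp_log hr]

theorem exists_hasDerivAt_eulerLogDeriv_canonicalMap_re (hθ : θ ∈ Ioo 0 π) :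
    ∃ D : ℝ, 0 < D ∧
      HasDerivAt (fun t : ℝ => (eulerLogDeriv (canonicalMap r x) (r * exp (t * I))).re) D θ := by
  have hderiv := hasDerivAt_comp_add_ofReal_mul_I
    (analyticAt_eulerLogDeriv_canonicalMap_comp_exp hr hx θ).differentiableAt.hasDerivAt
  have hre := reCLM.hasFDerivAt.comp_hasDerivAt θ hderiv
  simp only [reCLM_apply, Function.comp_def, mul_I_re, ← ofReal_mul_exp_mul_I_eq_exp hr] at hre
  exact ⟨_, neg_pos.2 (deriv_eulerLogDeriv_canonicalMap_comp_exp_im_neg hr hx hθ), hre⟩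

theorem strictMonoOn_eulerLogDeriv_canonicalMap_re :
    StrictMonoOn (fun t : ℝ => (eulerLogDeriv (canonicalMap r x) (r * exp (t * I))).re)
      (Ioo 0 π) := by
  refine strictMonoOn_of_deriv_pos (convex_Ioo _ _) (fun t ht => ?_) (fun t ht => ?_)
  · obtain ⟨D, -, hD⟩ := exists_hasDerivAt_eulerLogDeriv_canonicalMap_re hr hx ht
    exact hD.continuousAt.continuousWithinAt
  · obtain ⟨D, hpos, hD⟩ :=
      exists_hasDerivAt_eulerLogDeriv_canonicalMap_re hr hx (interior_subset ht)
    rwa [hD.deriv]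

theorem exists_canonicalMap_eq_mul_exp {m : ℝ} (hm : m ∈ Ioo 0 π)
    (heq : slit r (canonicalMap r x) = circularArc x m (2 * π - m)) :
    ∃ θ ∈ Ioo 0 π, canonicalMap r x (r * exp (θ * I)) = x * exp (m * I) := by
  have hmem : x * exp (m * I) ∈ canonicalMap r x '' sphere 0 r := by
    rw [← slit_canonicalMap hr hx, heq]
    exact mem_image_of_mem _ ⟨le_rfl, by linarith [hm.2]⟩
  obtain ⟨z, hz, hzm⟩ := hmem
  have hzr : r * exp (arg z * I) = z := by
    rw [← mem_sphere_zero_iff_norm.1 hz, norm_mul_exp_arg_mul_I]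
  refine ⟨arg z, arg_mem_Ioo_of_im_pos ?_, by rw [hzr, hzm]⟩
  refine im_pos_of_canonicalMap_im_pos hr hx (hzr ▸ mul_exp_mem_annulus hr hx (arg z)) ?_
  rw [hzm, mul_exp_ofReal_mul_I_im]
  exact mul_pos (hr.trans hx.1) (Real.sin_pos_of_mem_Ioo hm)

-- The argument of `f (r * exp (t * I))` is extremal where this point is an end of the slit.
theorem eulerLogDeriv_canonicalMap_re_eq_zero {m : ℝ} (hm : m ∈ Ioo 0 π)
    (heq : slit r (canonicalMap r x) = circularArc x m (2 * π - m))
    (hθ : canonicalMap r x (r * exp (θ * I)) = x * exp (m * I)) :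
    (eulerLogDeriv (canonicalMap r x) (r * exp (θ * I))).re = 0 := by
  have hx₀ := hr.trans hx.1
  have hmem (t : ℝ) : canonicalMap r x (r * exp (t * I)) ∈ canonicalMap r x '' sphere 0 r :=
    mem_image_of_mem _ (mul_exp_mem_sphere hr t)
  rw [← eulerLogDeriv_neg]
  refine eulerLogDeriv_re_eq_zero_of_isLocalMin_arg hr
    (analyticAt_canonicalMap hr hx (mul_exp_mem_annulus hr hx θ)).differentiableAt.neg
    (neg_mem_slitPlane_of_norm_eq (ρ := x)
      (mem_sphere_zero_iff_norm.1 (canonicalMap_image_sphere_subset hr hx (hmem θ)))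
      fun h => ofReal_notMem_canonicalMap_image_sphere hr hx (h ▸ hmem θ))
    (.of_forall fun t => ?_)
  obtain ⟨s, hs, hst⟩ : canonicalMap r x (r * exp (t * I)) ∈ circularArc x m (2 * π - m) := by
    rw [← heq, slit_canonicalMap hr hx]
    exact hmem t
  beta_reduce
  rw [hθ, ← hst, arg_neg_mul_exp hx₀ ⟨hm.1, by linarith [hm.2, Real.pi_pos]⟩,
    arg_neg_mul_exp hx₀ ⟨hm.1.trans_le hs.1, by linarith [hs.2, hm.1]⟩]
  linarith [hs.1]

theorem exists_isArcEndpoint_iff_eq_canonicalMap :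
    ∃ θ ∈ Ioo 0 π, (eulerLogDeriv (canonicalMap r x) (r * exp (θ * I))).re = 0 ∧
      ∀ w, IsArcEndpoint (slit r (canonicalMap r x)) w ∧ 0 < w.im ↔
        w = canonicalMap r x (r * exp (θ * I)) := by
  obtain ⟨m, hm, heq⟩ := exists_slit_canonicalMap_eq hr hx
  obtain ⟨θ, hθ, hθm⟩ := exists_canonicalMap_eq_mul_exp hr hx hm heq
  refine ⟨θ, hθ, eulerLogDeriv_canonicalMap_re_eq_zero hr hx hm heq hθm, fun w => ?_⟩
  rw [hθm, heq, isArcEndpoint_circularArc_and_im_pos_iff (hr.trans hx.1) hm]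

omit hx

theorem exists_contDiffOn_isArcEndpoint_iff :
    ∃ e : ℝ → ℂ, (∀ x ∈ Ioo r 1, ∀ w : ℂ,
      IsArcEndpoint (slit r (canonicalMap r x)) w ∧ 0 < w.im ↔ w = e x) ∧
      ContDiffOn ℝ ∞ e (Ioo r 1) := by
  choose! θ hθ hzero hiff using
    fun x (hx : x ∈ Ioo r 1) => exists_isArcEndpoint_iff_eq_canonicalMap hr hx
  have hsmooth : ContDiffOn ℝ ∞ θ (Ioo r 1) := by
    refine contDiffOn_of_unique_zero
      (F := fun p => (eulerLogDeriv (canonicalMap r p.1) (r * exp (p.2 * I))).re) isOpen_Ioo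
      (fun x hx => ⟨hθ x hx, hzero x hx⟩) (fun x hx t ht h₀ => ?_) (fun x hx => ?_)
      (fun x hx => ?_)
    · exact (strictMonoOn_eulerLogDeriv_canonicalMap_re hr hx).injOn ht (hθ x hx)
        (h₀.trans (hzero x hx).symm)
    · have hD := contDiffAt_eulerLogDeriv_canonicalMap hr hx (mul_exp_mem_annulus hr hx (θ x))
        (mul_exp_ne hr hx (θ x))
      exact reCLM.contDiff.contDiffAt.comp (x, θ x)
        (hD.comp (x, θ x) (contDiff_prodMk_mul_exp r).contDiffAt)
    · obtain ⟨D, hpos, hD⟩ := exists_hasDerivAt_eulerLogDeriv_canonicalMap_re hr hx (hθ x hx)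
      exact ⟨D, hpos.ne', hD⟩
  refine ⟨fun x => canonicalMap r x (r * exp (θ x * I)), hiff, fun x hx => ?_⟩
  have hf := contDiffAt_canonicalMap hr hx (mul_exp_mem_annulus hr hx (θ x))
  have hgraph : ContDiffAt ℝ ∞ (fun x => (x, θ x)) x :=
    contDiffAt_id.prodMk (hsmooth.contDiffAt (isOpen_Ioo.mem_nhds hx))
  exact ((hf.comp (x, θ x) (contDiff_prodMk_mul_exp r).contDiffAt).comp x hgraph).contDiffWithinAt

end CanonicalMap

/-! ### Uniqueness -/

theorem image_conj_circularArc (ρ a b : ℝ) :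
    conj '' circularArc ρ a b = circularArc ρ (-b) (-a) := by
  rw [circularArc, circularArc, ← image_neg_Icc, image_image, image_image]
  refine image_congr fun θ _ => ?_
  rw [map_mul, conj_ofReal, ← exp_conj, map_mul, conj_ofReal, conj_I, ofReal_neg, neg_mul, mul_neg]

theorem exists_circularArc_eq_of_conj_mem {ρ a b : ℝ} (hρ : 0 < ρ) (hab : a < b)
    (hb : b < a + 2 * π) (hconj : ∀ w ∈ circularArc ρ a b, conj w ∈ circularArc ρ a b)
    (hneg : ((-ρ : ℝ) : ℂ) ∈ circularArc ρ a b) :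
    ∃ m ∈ Ioo 0 π, circularArc ρ a b = circularArc ρ m (2 * π - m) := by
  have himage : conj '' circularArc ρ a b = circularArc ρ a b :=
    subset_antisymm (image_subset_iff.2 hconj) fun w hw =>
      ⟨conj w, hconj w hw, starRingEnd_self_apply w⟩
  rw [image_conj_circularArc] at himage
  obtain ⟨-, n, hn, -⟩ := circularArc_inj hρ (by linarith) hρ hab hb himage
  have hneg' : ρ * exp (π * I) ∈ circularArc ρ a b := by simpa using hneg
  obtain ⟨k, hk⟩ := (mul_exp_mem_circularArc_iff hρ.ne').1 hneg'
  have hcenter : a + b = 2 * (π + 2 * π * k) := by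
    have hlo : (-1 : ℝ) < 1 + 2 * k + n := by nlinarith [Real.pi_pos, hk.1]
    have hhi : (1 + 2 * k + n : ℝ) < 1 := by nlinarith [Real.pi_pos, hk.2]
    have hn' : n = -1 - 2 * k := by
      have hlo' : -1 < 1 + 2 * k + n := by exact_mod_cast hlo
      have hhi' : 1 + 2 * k + n < 1 := by exact_mod_cast hhi
      omega
    rw [hn'] at hn
    push_cast at hn
    linarith
  refine ⟨a - 2 * π * k, ⟨by linarith, by linarith⟩, ?_⟩
  rw [← circularArc_add_int ρ (a - 2 * π * k) _ k]
  congr 1 <;> linarith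

theorem IsCanonicalMap.exists_slit_eq {r x : ℝ} {g : ℂ → ℂ} (hg : IsCanonicalMap r x g) :
    ∃ ρ ∈ Ioo 0 1, ∃ m ∈ Ioo 0 π, slit r g = circularArc ρ m (2 * π - m) := by
  obtain ⟨ρ, a, b, hρ, hab, hb, heq⟩ := hg.arc
  obtain ⟨t, ht, ht₀, htΓ⟩ := hg.meets
  have hsymm := hg.symm
  rw [heq] at htΓ hsymm
  have htρ : -ρ = t := by
    have := mem_sphere_zero_iff_norm.1 (circularArc_subset_sphere hρ.le a b htΓ)
    rw [norm_real, Real.norm_of_nonpos ht₀.le] at this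
    linarith
  obtain ⟨m, hm, hmeq⟩ := exists_circularArc_eq_of_conj_mem hρ hab hb hsymm (htρ ▸ htΓ)
  exact ⟨ρ, ⟨hρ, by linarith⟩, m, hm, heq.trans hmeq⟩

/-- The filter of neighbourhoods of the inner boundary component of an annulus with inner
radius `a`, within the annulus. -/
noncomputable def innerEnd (a : ℝ) : Filter ℂ := comap norm (𝓝[>] a)

/-- The filter of neighbourhoods of the outer boundary component of an annulus with outer
radius `b`, within the annulus. -/
noncomputable def outerEnd (b : ℝ) : Filter ℂ := comap norm (𝓝[<] b)

theorem hasBasis_innerEnd (a : ℝ) : (innerEnd a).HasBasis (a < ·) (annulus a) :=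
  (nhdsGT_basis a).comap norm

theorem hasBasis_outerEnd (b : ℝ) : (outerEnd b).HasBasis (· < b) (annulus · b) :=
  (nhdsLT_basis b).comap norm

theorem tendsto_norm_innerEnd (a : ℝ) : Tendsto (fun z : ℂ => ‖z‖) (innerEnd a) (𝓝 a) :=
  tendsto_comap.mono_right nhdsWithin_le_nhds

theorem tendsto_norm_outerEnd (b : ℝ) : Tendsto (fun z : ℂ => ‖z‖) (outerEnd b) (𝓝 b) :=
  tendsto_comap.mono_right nhdsWithin_le_nhds

theorem nhdsWithin_annulus_le_innerEnd {a b : ℝ} {ζ : ℂ} (hζ : ‖ζ‖ = a) :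
    𝓝[annulus a b] ζ ≤ innerEnd a :=
  tendsto_iff_comap.1 <| tendsto_nhdsWithin_iff.2
    ⟨hζ ▸ continuous_norm.continuousAt.tendsto.mono_left nhdsWithin_le_nhds,
      eventually_mem_nhdsWithin.mono fun _ h => h.1⟩

theorem nhdsWithin_annulus_le_outerEnd {a b : ℝ} {ζ : ℂ} (hζ : ‖ζ‖ = b) :
    𝓝[annulus a b] ζ ≤ outerEnd b :=
  tendsto_iff_comap.1 <| tendsto_nhdsWithin_iff.2
    ⟨hζ ▸ continuous_norm.continuousAt.tendsto.mono_left nhdsWithin_le_nhds,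
      eventually_mem_nhdsWithin.mono fun _ h => h.2⟩

theorem disjoint_nhds_innerEnd {a : ℝ} {z : ℂ} (hz : ‖z‖ ≠ a) : Disjoint (𝓝 z) (innerEnd a) :=
  (continuous_norm.tendsto z).disjoint (disjoint_nhds_nhds.2 hz) (tendsto_norm_innerEnd a)

theorem eventually_mem_of_forall_mapClusterPt {X ι : Type*} [TopologicalSpace X] {l : Filter ι}
    {g : ι → X} {K O : Set X} (hK : IsCompact K) (hO : IsOpen O) (hgK : ∀ᶠ z in l, g z ∈ K)
    (h : ∀ w, MapClusterPt w l g → w ∈ O) : ∀ᶠ z in l, g z ∈ O := by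
  by_contra hfreq
  obtain ⟨w, hw, hcluster⟩ := (hK.diff hO).exists_mapClusterPt_of_frequently
    ((not_eventually.1 hfreq).and_eventually hgK |>.mono fun _ hz => ⟨hz.2, hz.1⟩)
  exact hw.2 (h w hcluster)

theorem notMem_image_of_mapClusterPt {g : ℂ → ℂ} {U : Set ℂ} (hU : IsOpen U)
    (hg : DifferentiableOn ℂ g U) (hinj : InjOn g U) {l : Filter ℂ} (hlU : ∀ᶠ z in l, z ∈ U)
    (hl : ∀ z ∈ U, Disjoint (𝓝 z) l) {w : ℂ} (hw : MapClusterPt w l g) : w ∉ g '' U := by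
  rintro ⟨z, hz, rfl⟩
  obtain ⟨s, hs, t, ht, hst⟩ := Filter.disjoint_iff.1 (hl z hz)
  have han := hg.analyticAt (hU.mem_nhds hz)
  have hmap := han.hasStrictDerivAt.map_nhds_eq (deriv_ne_zero_of_injOn han (hU.mem_nhds hz) hinj)
  have himage : g '' (s ∩ U) ∈ 𝓝 (g z) := hmap ▸ image_mem_map (inter_mem hs (hU.mem_nhds hz))
  obtain ⟨y, ⟨v, hv, hvy⟩, hyU, hyt⟩ :=
    ((hw.frequently himage).and_eventually (hlU.and ht)).exists
  exact hst.notMem_of_mem_left hv.1 (hinj hv.2 hyU hvy ▸ hyt)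

theorem eventually_lt_or_eventually_gt_innerEnd {u : ℂ → ℝ} {a b c : ℝ} (hab : a < b)
    (hu : ContinuousOn u (annulus a b)) (hne : ∀ᶠ z in innerEnd a, u z ≠ c) :
    (∀ᶠ z in innerEnd a, u z < c) ∨ ∀ᶠ z in innerEnd a, c < u z := by
  obtain ⟨s, hs, hsub⟩ := (hasBasis_innerEnd a).eventually_iff.1
    (hne.and ((hasBasis_innerEnd a).mem_of_mem hab))
  have himage : u '' annulus a s ⊆ Iio c ∪ Ioi c := by
    rintro - ⟨z, hz, rfl⟩
    exact (hsub hz).1.lt_or_gt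
  have hpre := (isPreconnected_annulus a s).image u (hu.mono fun z hz => (hsub hz).2)
  refine (hpre.subset_or_subset isOpen_Iio isOpen_Ioi
    (disjoint_left.2 fun _ => lt_asymm) himage).imp (fun h => ?_) fun h => ?_ <;>
  exact (hasBasis_innerEnd a).eventually_iff.2 ⟨s, hs, fun z hz => h (mem_image_of_mem _ hz)⟩

namespace IsCanonicalMap

variable {r x σ : ℝ} {g : ℂ → ℂ} (hg : IsCanonicalMap r x g)

include hg

theorem eventually_mem_closedBall_of_le {l : Filter ℂ} (hl : ∀ᶠ z in l, z ∈ annulus r 1) :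
    ∀ᶠ z in l, g z ∈ closedBall 0 1 :=
  hl.mono fun _ hz => ball_subset_closedBall (hg.mapsTo hz)

theorem mem_sphere_of_mapClusterPt_outerEnd (hr1 : r < 1) {w : ℂ}
    (hw : MapClusterPt w (outerEnd 1) g) : w ∈ sphere (0 : ℂ) 1 := by
  obtain ⟨U, hU, hlim⟩ := mapClusterPt_iff_ultrafilter.1 hw
  have hUA : ∀ᶠ z in U, z ∈ annulus r 1 := hU ((hasBasis_outerEnd 1).mem_of_mem hr1)
  obtain ⟨ζ, -, hζ⟩ := (isCompact_closedBall (0 : ℂ) 1).ultrafilter_le_nhds U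
    (le_principal_iff.2 (hUA.mono fun z hz => mem_closedBall_zero_iff.2 hz.2.le))
  have hζ₁ : ‖ζ‖ = 1 := tendsto_nhds_unique ((continuous_norm.tendsto ζ).mono_left hζ)
    ((tendsto_norm_outerEnd 1).mono_left hU)
  exact hg.circle_to_circle ζ (mem_sphere_zero_iff_norm.2 hζ₁) w
    (mapClusterPt_iff_ultrafilter.2 ⟨U, le_inf hζ (le_principal_iff.2 hUA), hlim⟩)

theorem tendsto_norm_outerEnd (hr1 : r < 1) : Tendsto (fun z => ‖g z‖) (outerEnd 1) (𝓝 1) := by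
  refine tendsto_nhds.2 fun s hs h₁ => ?_
  refine eventually_mem_of_forall_mapClusterPt (O := {w : ℂ | ‖w‖ ∈ s}) (isCompact_closedBall 0 1)
    (hs.preimage continuous_norm)
    (hg.eventually_mem_closedBall_of_le ((hasBasis_outerEnd 1).mem_of_mem hr1)) fun w hw => ?_
  rwa [mem_ofPred_eq, mem_sphere_zero_iff_norm.1 (hg.mem_sphere_of_mapClusterPt_outerEnd hr1 hw)]

theorem mem_slit_of_mapClusterPt_innerEnd (hr1 : r < 1) {w : ℂ}
    (hw : MapClusterPt w (innerEnd r) g) (hw₁ : ‖w‖ < 1) : w ∈ slit r g :=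
  ⟨mem_ball_zero_iff.2 hw₁, notMem_image_of_mapClusterPt (isOpen_annulus r 1) hg.holo hg.inj
    ((hasBasis_innerEnd r).mem_of_mem hr1) (fun _ hz => disjoint_nhds_innerEnd hz.1.ne') hw⟩

theorem eventually_norm_ne_innerEnd (hr1 : r < 1) (hσ : slit r g ⊆ ball 0 σ) (hσ₁ : σ < 1) :
    ∀ᶠ z in innerEnd r, ‖g z‖ ≠ σ := by
  refine eventually_mem_of_forall_mapClusterPt (O := {w : ℂ | ‖w‖ ≠ σ}) (isCompact_closedBall 0 1)
    (isOpen_ne_fun continuous_norm continuous_const)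
    (hg.eventually_mem_closedBall_of_le ((hasBasis_innerEnd r).mem_of_mem hr1)) fun w hw heq => ?_
  exact (mem_ball_zero_iff.1
    (hσ (hg.mem_slit_of_mapClusterPt_innerEnd hr1 hw (heq.trans_lt hσ₁)))).ne heq

-- Otherwise the part of the image in `ball 0 σ` would be the image of a compact set, hence closed,
-- and could not accumulate on the slit.
theorem not_eventually_lt_norm_innerEnd (hr1 : r < 1) {ρ : ℝ} (hρ : ρ ≠ 0)
    (hρΓ : slit r g ⊆ sphere 0 ρ) (hσ : slit r g ⊆ ball 0 σ) (hσ₁ : σ < 1) :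
    ¬ ∀ᶠ z in innerEnd r, σ < ‖g z‖ := by
  intro hinner
  obtain ⟨a, ha, hain⟩ := (hasBasis_innerEnd r).eventually_iff.1 hinner
  obtain ⟨b, hb, hbout⟩ := (hasBasis_outerEnd 1).eventually_iff.1
    ((hg.tendsto_norm_outerEnd hr1).eventually_const_lt hσ₁)
  set K : Set ℂ := {z | a ≤ ‖z‖ ∧ ‖z‖ ≤ b}
  have hKA : K ⊆ annulus r 1 := fun z hz => ⟨ha.trans_le hz.1, hz.2.trans_lt hb⟩
  have hK : IsCompact K := isCompact_of_isClosed_isBounded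
    ((isClosed_le continuous_const continuous_norm).inter
      (isClosed_le continuous_norm continuous_const)) ((isBounded_annulus r 1).subset hKA)
  have hball : ball 0 σ ∩ (sphere 0 ρ)ᶜ ⊆ g '' K := by
    rintro w ⟨hw, hwρ⟩
    have hwσ := mem_ball_zero_iff.1 hw
    obtain ⟨z, hz, rfl⟩ : w ∈ g '' annulus r 1 := by
      by_contra hwA
      exact hwρ (hρΓ ⟨mem_ball_zero_iff.2 (hwσ.trans hσ₁), hwA⟩)
    refine mem_image_of_mem _ ⟨?_, ?_⟩ <;> by_contra! h
    · exact hwσ.not_gt (hain ⟨hz.1, h⟩)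
    · exact hwσ.not_gt (hbout ⟨h, hz.2⟩)
  have hdense : Dense (sphere (0 : ℂ) ρ)ᶜ := interior_eq_empty_iff_dense_compl.1
    (interior_sphere 0 hρ)
  obtain ⟨t, -, -, ht⟩ := hg.meets
  have hclosed := (hK.image_of_continuousOn (hg.holo.continuousOn.mono hKA)).isClosed
  have htK := closure_minimal hball hclosed (hdense.open_subset_closure_inter isOpen_ball (hσ ht))
  exact ht.2 (image_mono hKA htK)

theorem eventually_mem_innerEnd (hr1 : r < 1) {O : Set ℂ} (hO : IsOpen O) (hΓ : slit r g ⊆ O) :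
    ∀ᶠ z in innerEnd r, g z ∈ O := by
  obtain ⟨ρ, hρ, m, -, heq⟩ := hg.exists_slit_eq
  have hρΓ : slit r g ⊆ sphere 0 ρ := heq ▸ circularArc_subset_sphere hρ.1.le _ _
  obtain ⟨σ, hρσ, hσ₁⟩ := exists_between hρ.2
  have hσ := hρΓ.trans (sphere_subset_ball hρσ)
  have hlt : ∀ᶠ z in innerEnd r, ‖g z‖ < σ :=
    (eventually_lt_or_eventually_gt_innerEnd hr1 hg.holo.continuousOn.norm
      (hg.eventually_norm_ne_innerEnd hr1 hσ hσ₁)).resolve_right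
      (hg.not_eventually_lt_norm_innerEnd hr1 hρ.1.ne' hρΓ hσ hσ₁)
  have hclosed : ∀ᶠ z in innerEnd r, g z ∈ closedBall 0 σ :=
    hlt.mono fun z hz => mem_closedBall_zero_iff.2 hz.le
  refine eventually_mem_of_forall_mapClusterPt (isCompact_closedBall 0 σ) hO hclosed
    fun w hw => hΓ (hg.mem_slit_of_mapClusterPt_innerEnd hr1 hw ?_)
  exact (mem_closedBall_zero_iff.1 (isClosed_closedBall.mem_of_mapClusterPt hw hclosed)).trans_lt
    hσ₁

theorem tendsto_norm_innerEnd (hr1 : r < 1) {ρ : ℝ} (hρΓ : slit r g ⊆ sphere 0 ρ) :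
    Tendsto (fun z => ‖g z‖) (innerEnd r) (𝓝 ρ) := by
  refine tendsto_nhds.2 fun s hs hρ => ?_
  refine hg.eventually_mem_innerEnd hr1 (hs.preimage continuous_norm) fun w hw => ?_
  rwa [mem_preimage, mem_sphere_zero_iff_norm.1 (hρΓ hw)]

end IsCanonicalMap

theorem isLocallyHolomorphicNormOn_norm_mul_rpow {f : ℂ → ℂ} {U : Set ℂ} (hU : IsOpen U)
    (hf : DifferentiableOn ℂ f U) (h₀ : (0 : ℂ) ∉ U) (κ : ℝ) :
    IsLocallyHolomorphicNormOn (fun z => ‖f z‖ * ‖z‖ ^ κ) U := by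
  intro z hz
  have hz₀ : z ≠ 0 := ne_of_mem_of_not_mem hz h₀
  have hquot : Tendsto (fun w => w / z) (𝓝 z) (𝓝 1) :=
    div_self hz₀ ▸ tendsto_id.div_const z
  have hslit : ∀ᶠ w in 𝓝 z, w / z ∈ slitPlane :=
    hquot.eventually (isOpen_slitPlane.mem_nhds one_mem_slitPlane)
  refine ⟨fun w => f w * (w / z) ^ (κ : ℂ) * (‖z‖ ^ κ : ℝ), ?_, .of_forall fun w => ?_⟩
  · filter_upwards [hU.mem_nhds hz, hslit] with w hw hws
    exact ((hf.differentiableAt (hU.mem_nhds hw)).mul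
      ((differentiableAt_id.div_const z).cpow_const hws)).mul_const _
  · have hpos : 0 < ‖z‖ ^ κ := Real.rpow_pos_of_pos (norm_pos_iff.2 hz₀) κ
    rw [norm_mul, norm_mul, norm_cpow_real, norm_div, norm_real, Real.norm_of_nonneg hpos.le,
      Real.div_rpow (norm_nonneg w) (norm_nonneg z), mul_assoc, div_mul_cancel₀ _ hpos.ne']

section

variable {a b κ : ℝ} {f : ℂ → ℂ}

theorem norm_le_rpow_norm_of_tendsto (ha : 0 < a) (hf : DifferentiableOn ℂ f (annulus a b))
    (hin : Tendsto (fun z => ‖f z‖) (innerEnd a) (𝓝 (a ^ κ)))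
    (hout : Tendsto (fun z => ‖f z‖) (outerEnd b) (𝓝 (b ^ κ))) {z : ℂ} (hz : z ∈ annulus a b) :
    ‖f z‖ ≤ ‖z‖ ^ κ := by
  have hlim {l : Filter ℂ} {s : ℝ} (hs : 0 < s) (hl : Tendsto (fun z : ℂ => ‖z‖) l (𝓝 s))
      (hfl : Tendsto (fun z => ‖f z‖) l (𝓝 (s ^ κ))) :
      Tendsto (fun z => ‖f z‖ * ‖z‖ ^ (-κ)) l (𝓝 1) := by
    have := hfl.mul (hl.rpow_const (p := -κ) (.inl hs.ne'))
    rwa [← Real.rpow_add hs, add_neg_cancel, Real.rpow_zero] at this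
  have h₀ : (0 : ℂ) ∉ annulus a b := fun h => ha.not_gt (norm_zero (E := ℂ) ▸ h.1)
  have hle : ‖f z‖ * ‖z‖ ^ (-κ) ≤ 1 := by
    refine (isLocallyHolomorphicNormOn_norm_mul_rpow (isOpen_annulus a b) hf h₀ (-κ)).le_of_frontier
      (isOpen_annulus a b) (isBounded_annulus a b) (fun ζ hζ c hc => ?_) hz
    rcases norm_mem_of_mem_frontier_annulus hζ with h | h
    · exact ((hlim ha (tendsto_norm_innerEnd a) hin).mono_left
        (nhdsWithin_annulus_le_innerEnd h)).eventually_lt_const hc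
    · exact ((hlim (ha.trans (hz.1.trans hz.2)) (tendsto_norm_outerEnd b) hout).mono_left
        (nhdsWithin_annulus_le_outerEnd h)).eventually_lt_const hc
  have hpos : 0 < ‖z‖ := ha.trans hz.1
  rwa [Real.rpow_neg hpos.le, ← div_eq_mul_inv, div_le_one (Real.rpow_pos_of_pos hpos κ)] at hle

theorem norm_eq_rpow_norm_of_tendsto (ha : 0 < a) (hf : DifferentiableOn ℂ f (annulus a b))
    (hf₀ : ∀ z ∈ annulus a b, f z ≠ 0)
    (hin : Tendsto (fun z => ‖f z‖) (innerEnd a) (𝓝 (a ^ κ)))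
    (hout : Tendsto (fun z => ‖f z‖) (outerEnd b) (𝓝 (b ^ κ))) {z : ℂ} (hz : z ∈ annulus a b) :
    ‖f z‖ = ‖z‖ ^ κ := by
  have hb : 0 < b := ha.trans (hz.1.trans hz.2)
  have hinv {l : Filter ℂ} {s : ℝ} (hs : 0 < s) (hfl : Tendsto (fun z => ‖f z‖) l (𝓝 (s ^ κ))) :
      Tendsto (fun z => ‖(f z)⁻¹‖) l (𝓝 (s ^ (-κ))) := by
    simpa only [norm_inv, Real.rpow_neg hs.le] using hfl.inv₀ (Real.rpow_pos_of_pos hs κ).ne'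
  have hle := norm_le_rpow_norm_of_tendsto ha (hf.inv hf₀) (hinv ha hin) (hinv hb hout) hz
  rw [Pi.inv_apply, norm_inv, Real.rpow_neg (norm_nonneg z)] at hle
  exact (norm_le_rpow_norm_of_tendsto ha hf hin hout hz).antisymm
    ((inv_le_inv₀ (norm_pos_iff.2 (hf₀ z hz)) (Real.rpow_pos_of_pos (ha.trans hz.1) κ)).1 hle)

theorem eq_zero_of_re_eq_mul_log_norm {H : ℂ → ℂ} (ha : 0 < a) (hab : a < b)
    (hH : DifferentiableOn ℂ H (annulus a b))
    (hre : ∀ z ∈ annulus a b, (H z).re = κ * Real.log ‖z‖) : κ = 0 := by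
  set S : Set ℂ := re ⁻¹' Ioo (Real.log a) (Real.log b)
  have hSo : IsOpen S := isOpen_Ioo.preimage continuous_re
  have hSc : Convex ℝ S := (convex_Ioo _ _).linear_preimage reLm
  have hexp : MapsTo exp S (annulus a b) := fun w hw => by
    rw [annulus, mem_ofPred_eq, norm_exp, ← Real.log_lt_iff_lt_exp ha,
      ← Real.lt_log_iff_exp_lt (ha.trans hab)]
    exact hw
  have hK : DifferentiableOn ℂ (fun w => H (exp w) - κ * w) S :=
    (hH.comp differentiable_exp.differentiableOn hexp).sub (by fun_prop)
  obtain ⟨t, ht⟩ := exists_between (Real.log_lt_log ha hab)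
  obtain ⟨c, hc⟩ := (hK.analyticOnNhd hSo).eq_const_of_re_eq_const (c₀ := 0)
    (fun w hw => by simp [hre _ (hexp hw), norm_exp]) hSo
    ⟨⟨t, by simpa [S] using ht⟩, hSc.isPreconnected⟩
  have h₁ := hc t (by simpa [S] using ht)
  have h₂ := hc (t + 2 * π * I) (by simpa [S] using ht)
  rw [exp_periodic, ← h₁] at h₂
  have : (κ : ℂ) * (2 * π * I) = 0 := by linear_combination -h₂
  simpa using this

end

/- The modulus of `f` is a power of `‖z‖`; the exponent vanishes because `f` has a logarithm near
the inner circle. -/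
theorem exists_eqOn_const_of_tendsto_norm {f H : ℂ → ℂ} {r s c : ℝ} (hr : 0 < r)
    (hs : s ∈ Ioc r 1) (hc : 0 < c) (hf : DifferentiableOn ℂ f (annulus r 1))
    (hf₀ : ∀ z ∈ annulus r 1, f z ≠ 0)
    (hin : Tendsto (fun z => ‖f z‖) (innerEnd r) (𝓝 c))
    (hout : Tendsto (fun z => ‖f z‖) (outerEnd 1) (𝓝 1))
    (hH : DifferentiableOn ℂ H (annulus r s)) (hHf : ∀ z ∈ annulus r s, exp (H z) = f z) :
    ∃ u : ℂ, ‖u‖ = 1 ∧ EqOn f (fun _ => u) (annulus r 1) := by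
  have hr1 : r < 1 := hs.1.trans_le hs.2
  obtain ⟨κ, rfl⟩ : ∃ κ : ℝ, r ^ κ = c := ⟨Real.logb r c, Real.rpow_logb hr hr1.ne hc⟩
  have hnorm : ∀ z ∈ annulus r 1, ‖f z‖ = ‖z‖ ^ κ := fun z =>
    norm_eq_rpow_norm_of_tendsto hr hf hf₀ hin (by rwa [Real.one_rpow])
  have hκ : κ = 0 := eq_zero_of_re_eq_mul_log_norm hr hs.1 hH fun z hz => by
    rw [← Real.log_rpow (hr.trans hz.1), ← hnorm z (annulus_subset_annulus le_rfl hs.2 hz),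
      ← hHf z hz, norm_exp, Real.log_exp]
  simp only [hκ, Real.rpow_zero] at hnorm
  obtain ⟨t, ht⟩ := exists_between hr1
  have htA := ofReal_mem_annulus hr ht
  exact ⟨f t, hnorm t htA, eqOn_of_isPreconnected_of_isMaxOn_norm (isPreconnected_annulus r 1)
    (isOpen_annulus r 1) hf htA fun z hz => ((hnorm z hz).trans (hnorm t htA).symm).le⟩

theorem slit_eq_image_of_eqOn_mul {r : ℝ} {f g : ℂ → ℂ} {u : ℂ} (hu : ‖u‖ = 1)
    (h : EqOn g (fun z => u * f z) (annulus r 1)) : slit r g = (u * ·) '' slit r f := by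
  have hu₀ : u ≠ 0 := norm_ne_zero_iff.1 (hu ▸ one_ne_zero)
  have hball : (u * ·) '' ball (0 : ℂ) 1 = ball 0 1 := by
    simpa [hu, ← image_smul] using smul_ball hu₀ (0 : ℂ) 1
  rw [slit, slit, image_sdiff (mul_right_injective₀ hu₀), hball, h.image_eq, image_image]

theorem image_mul_exp_circularArc (ρ a b φ : ℝ) :
    (exp (φ * I) * ·) '' circularArc ρ a b = circularArc ρ (φ + a) (φ + b) := by
  rw [circularArc, circularArc, ← image_const_add_Icc, image_image, image_image]
  refine image_congr fun θ _ => ?_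
  rw [ofReal_add, add_mul, exp_add]
  ring

theorem eq_one_of_image_mul_circularArc_eq {u : ℂ} {ρ m ρ' m' : ℝ} (hu : ‖u‖ = 1)
    (hρ : 0 < ρ) (hm : m ∈ Ioo 0 π) (hρ' : 0 < ρ') (hm' : m' ∈ Ioo 0 π)
    (h : (u * ·) '' circularArc ρ m (2 * π - m) = circularArc ρ' m' (2 * π - m')) : u = 1 := by
  have hexp : exp (arg u * I) = u := by simpa [hu] using norm_mul_exp_arg_mul_I u
  rw [← hexp, image_mul_exp_circularArc] at h
  obtain ⟨-, n, hn, hn'⟩ := circularArc_inj hρ (by linarith [hm.1]) hρ' (by linarith [hm'.2])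
    (by linarith [hm'.1]) h
  have harg : arg u = n * (2 * π) := by linarith
  rw [← hexp, harg, exp_eq_one_iff]
  exact ⟨n, by push_cast; ring⟩

theorem neg_mem_slitPlane_of_mem_circularArc {ρ m : ℝ} (hρ : 0 < ρ) (hm : m ∈ Ioo 0 π) {w : ℂ}
    (hw : w ∈ circularArc ρ m (2 * π - m)) : -w ∈ slitPlane := by
  refine neg_mem_slitPlane_of_norm_eq
    (mem_sphere_zero_iff_norm.1 (circularArc_subset_sphere hρ.le _ _ hw)) ?_
  rintro rfl
  have hmem : (ρ : ℂ) ∈ circularArc ρ m (2 * π - m) ∩ {w | w.im = 0} := ⟨hw, ofReal_im ρ⟩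
  rw [circularArc_inter_im_eq_zero hρ hm, mem_singleton_iff] at hmem
  exact hρ.ne' (self_eq_neg.1 (by exact_mod_cast hmem))

namespace IsCanonicalMap

variable {r x : ℝ} {f g : ℂ → ℂ}

theorem eq_sub_mul_dslope (hf : IsCanonicalMap r x f) (z : ℂ) : f z = (z - x) * dslope f x z := by
  rw [← smul_eq_mul, sub_smul_dslope, hf.map_zero, sub_zero]

theorem dslope_ne_zero (hr : 0 < r) (hx : x ∈ Ioo r 1) (hf : IsCanonicalMap r x f) {z : ℂ}
    (hz : z ∈ annulus r 1) : dslope f x z ≠ 0 := by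
  have hxA := ofReal_mem_annulus hr hx
  have hnhds := (isOpen_annulus r 1).mem_nhds hxA
  intro h₀
  by_cases hzx : z = x
  · rw [hzx, dslope_same] at h₀
    exact deriv_ne_zero_of_injOn (hf.holo.analyticAt hnhds) hnhds hf.inj h₀
  · refine hzx (hf.inj hz hxA ?_)
    rw [hf.map_zero, hf.eq_sub_mul_dslope, h₀, mul_zero]

theorem dslope_div_dslope (hf : IsCanonicalMap r x f) (hg : IsCanonicalMap r x g) {z : ℂ}
    (hz : z ≠ x) : dslope f x z / dslope g x z = f z / g z := by
  rw [hf.eq_sub_mul_dslope z, hg.eq_sub_mul_dslope z, mul_div_mul_left _ _ (sub_ne_zero.2 hz)]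

theorem tendsto_norm_dslope_div_dslope (hf : IsCanonicalMap r x f) (hg : IsCanonicalMap r x g)
    (hx : 0 < x) {l : Filter ℂ} {s c d : ℝ} (hl : Tendsto (fun z : ℂ => ‖z‖) l (𝓝 s)) (hs : s ≠ x)
    (hfl : Tendsto (fun z => ‖f z‖) l (𝓝 c)) (hgl : Tendsto (fun z => ‖g z‖) l (𝓝 d))
    (hd : d ≠ 0) : Tendsto (fun z => ‖dslope f x z / dslope g x z‖) l (𝓝 (c / d)) := by
  refine (hfl.div hgl hd).congr' ?_
  filter_upwards [hl.eventually_ne hs] with z hz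
  have hzx : z ≠ x := fun h => hz (by rw [h, norm_real, Real.norm_of_nonneg hx.le])
  rw [hf.dslope_div_dslope hg hzx, norm_div, Pi.div_apply]

theorem eventually_neg_mem_slitPlane (hf : IsCanonicalMap r x f) (hr1 : r < 1) :
    ∀ᶠ z in innerEnd r, -f z ∈ slitPlane := by
  obtain ⟨ρ, hρ, m, hm, heq⟩ := hf.exists_slit_eq
  exact hf.eventually_mem_innerEnd (O := {w | -w ∈ slitPlane}) hr1
    (isOpen_slitPlane.preimage continuous_neg)
    fun w hw => neg_mem_slitPlane_of_mem_circularArc hρ.1 hm (heq ▸ hw)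

theorem exists_exp_eq_dslope_div_dslope (hr : 0 < r) (hx : x ∈ Ioo r 1)
    (hf : IsCanonicalMap r x f) (hg : IsCanonicalMap r x g) :
    ∃ s ∈ Ioc r 1, ∃ H : ℂ → ℂ, DifferentiableOn ℂ H (annulus r s) ∧
      ∀ z ∈ annulus r s, exp (H z) = dslope f x z / dslope g x z := by
  have hr1 := hx.1.trans hx.2
  obtain ⟨s, hs, hsub⟩ := (hasBasis_innerEnd r).eventually_iff.1
    ((hf.eventually_neg_mem_slitPlane hr1).and (hg.eventually_neg_mem_slitPlane hr1))
  have hsx : annulus r (min s x) ⊆ annulus r s := annulus_subset_annulus le_rfl (min_le_left s x)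
  have hs1 : annulus r (min s x) ⊆ annulus r 1 :=
    annulus_subset_annulus le_rfl ((min_le_right s x).trans hx.2.le)
  refine ⟨min s x, ⟨lt_min hs hx.1, (min_le_right s x).trans hx.2.le⟩,
    fun z => log (-f z) - log (-g z), ?_, fun z hz => ?_⟩
  · exact ((hf.holo.mono hs1).neg.clog fun z hz => (hsub (hsx hz)).1).sub
      ((hg.holo.mono hs1).neg.clog fun z hz => (hsub (hsx hz)).2)
  · have hzx : z ≠ x := by
      rintro rfl
      have := hz.2.trans_le (min_le_right s x)
      rw [norm_real, Real.norm_of_nonneg (hr.trans hx.1).le] at this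
      exact this.false
    obtain ⟨hfz, hgz⟩ := hsub (hsx hz)
    rw [exp_sub, exp_log (slitPlane_ne_zero hfz), exp_log (slitPlane_ne_zero hgz), neg_div_neg_eq,
      hf.dslope_div_dslope hg hzx]

theorem exists_eqOn_mul (hr : 0 < r) (hx : x ∈ Ioo r 1) (hf : IsCanonicalMap r x f)
    (hg : IsCanonicalMap r x g) :
    ∃ u : ℂ, ‖u‖ = 1 ∧ EqOn f (fun z => u * g z) (annulus r 1) := by
  have hr1 := hx.1.trans hx.2
  have hx₀ := hr.trans hx.1
  have hnhds := (isOpen_annulus r 1).mem_nhds (ofReal_mem_annulus hr hx)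
  obtain ⟨ρ, hρ, m, -, hfρ⟩ := hf.exists_slit_eq
  obtain ⟨σ, hσ, n, -, hgσ⟩ := hg.exists_slit_eq
  obtain ⟨s, hs, H, hH, hHeq⟩ := hf.exists_exp_eq_dslope_div_dslope hr hx hg
  have hin := hf.tendsto_norm_dslope_div_dslope hg hx₀ (_root_.tendsto_norm_innerEnd r) hx.1.ne
    (hf.tendsto_norm_innerEnd hr1 (hfρ ▸ circularArc_subset_sphere hρ.1.le _ _))
    (hg.tendsto_norm_innerEnd hr1 (hgσ ▸ circularArc_subset_sphere hσ.1.le _ _)) hσ.1.ne'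
  have hout := hf.tendsto_norm_dslope_div_dslope hg hx₀ (_root_.tendsto_norm_outerEnd 1) hx.2.ne'
    (hf.tendsto_norm_outerEnd hr1) (hg.tendsto_norm_outerEnd hr1) one_ne_zero
  rw [div_one] at hout
  obtain ⟨u, hu, hfu⟩ := exists_eqOn_const_of_tendsto_norm hr hs (div_pos hρ.1 hσ.1)
    (((differentiableOn_dslope hnhds).2 hf.holo).div ((differentiableOn_dslope hnhds).2 hg.holo)
      fun z hz => hg.dslope_ne_zero hr hx hz)
    (fun z hz => div_ne_zero (hf.dslope_ne_zero hr hx hz) (hg.dslope_ne_zero hr hx hz))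
    hin hout hH hHeq
  refine ⟨u, hu, fun z hz => ?_⟩
  beta_reduce
  rw [hf.eq_sub_mul_dslope z, hg.eq_sub_mul_dslope z,
    (div_eq_iff (hg.dslope_ne_zero hr hx hz)).1 (hfu hz), mul_left_comm]

theorem eqOn (hr : 0 < r) (hx : x ∈ Ioo r 1) (hf : IsCanonicalMap r x f)
    (hg : IsCanonicalMap r x g) : EqOn f g (annulus r 1) := by
  obtain ⟨u, hu, hfu⟩ := hf.exists_eqOn_mul hr hx hg
  obtain ⟨ρ, hρ, m, hm, hfρ⟩ := hf.exists_slit_eq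
  obtain ⟨σ, hσ, n, hn, hgσ⟩ := hg.exists_slit_eq
  have hslit := slit_eq_image_of_eqOn_mul hu hfu
  rw [hfρ, hgσ] at hslit
  have hu₁ := eq_one_of_image_mul_circularArc_eq hu hσ.1 hn hρ.1 hm hslit.symm
  simpa only [hu₁, one_mul] using hfu

end IsCanonicalMap

theorem IsCanonicalMap.eqOn_canonicalMap {r x : ℝ} {f : ℂ → ℂ} (hr : 0 < r) (hx : x ∈ Ioo r 1)
    (hf : IsCanonicalMap r x f) : EqOn f (canonicalMap r x) (annulus r 1) :=
  hf.eqOn hr hx (isCanonicalMap_canonicalMap hr hx)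

theorem IsCanonicalMap.slit_eq {r x : ℝ} {f : ℂ → ℂ} (hr : 0 < r) (hx : x ∈ Ioo r 1)
    (hf : IsCanonicalMap r x f) : slit r f = slit r (canonicalMap r x) := by
  rw [slit, slit, (hf.eqOn_canonicalMap hr hx).image_eq]

theorem exists_hasDerivAt_canonicalMap_self {r x : ℝ} (hr : 0 < r) (hx : x ∈ Ioo r 1) :
    ∃ d : ℝ, HasDerivAt (canonicalMap r x) (d : ℂ) (x : ℂ) ∧
      HasDerivAt (fun α : ℝ => canonicalMap r α x) (-(d : ℂ)) x ∧ 1 / (1 - x ^ 2) < d := by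
  obtain ⟨d, hd, hlt⟩ := exists_thetaQuotient_self_eq_ofReal hr hx
  have hderiv : HasDerivAt (canonicalMap r x) (d : ℂ) x := hd ▸ hasDerivAt_canonicalMap_self hr hx
  exact ⟨d, hderiv, hderiv.comp_ofReal.neg.congr_of_eventuallyEq
    (.of_forall fun α => canonicalMap_antisymm r x α), hlt⟩

theorem lemma5p1 (r : ℝ) (hr0 : 0 < r) (hr1 : r < 1) :
    -- the canonical map exists and is unique, as a map on the annulus
    (∀ x ∈ Set.Ioo r 1, ∃ f : ℂ → ℂ, IsCanonicalMap r x f ∧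
      ∀ g : ℂ → ℂ, IsCanonicalMap r x g → Set.EqOn g f (annulus r 1)) ∧
    ∀ f : ℝ → ℂ → ℂ, (∀ x ∈ Set.Ioo r 1, IsCanonicalMap r x (f x)) →
      -- (A) holomorphic extension, jointly smooth
      (∃ F : ℝ → ℂ → ℂ,
        (∀ x ∈ Set.Ioo r 1, Set.EqOn (F x) (f x) (annulus r 1) ∧
          DifferentiableOn ℂ (F x) (annulus (r ^ 2 / x) (1 / x))) ∧
        ContDiffOn ℝ ∞ (fun p : ℝ × ℂ => F p.1 p.2)
          {p : ℝ × ℂ | p.1 ∈ Set.Ioo r 1 ∧ p.2 ∈ annulus (r ^ 2 / p.1) (1 / p.1)}) ∧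
      -- (B) antisymmetry and derivative
      (∀ x ∈ Set.Ioo r 1, ∀ α ∈ Set.Ioo r 1, f α (x : ℂ) = -f x (α : ℂ)) ∧
      (∀ x ∈ Set.Ioo r 1, ∃ d : ℝ, HasDerivAt (f x) (d : ℂ) (x : ℂ) ∧
        HasDerivAt (fun α : ℝ => f α (x : ℂ)) (-(d : ℂ)) x ∧ -d < -(1 / (1 - x ^ 2))) ∧
      -- (C) intersection of the slit with the real line
      (∀ x ∈ Set.Ioo r 1, slit r (f x) ∩ {w : ℂ | w.im = 0} = {(-x : ℂ)}) ∧
      -- (D) the endpoint in the upper half-plane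
      (∃ e : ℝ → ℂ,
        (∀ x ∈ Set.Ioo r 1, ∀ w : ℂ,
          (IsArcEndpoint (slit r (f x)) w ∧ 0 < w.im) ↔ w = e x) ∧
        ContDiffOn ℝ ∞ e (Set.Ioo r 1)) := by
  refine ⟨fun x hx => ⟨canonicalMap r x, isCanonicalMap_canonicalMap hr0 hx,
    fun g hg => hg.eqOn_canonicalMap hr0 hx⟩, fun f hf => ?_⟩
  have heq {x : ℝ} (hx : x ∈ Ioo r 1) := (hf x hx).eqOn_canonicalMap hr0 hx
  have hA {x : ℝ} (hx : x ∈ Ioo r 1) := ofReal_mem_annulus hr0 hx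
  refine ⟨⟨canonicalMap r, fun x hx => ⟨(heq hx).symm, differentiableOn_canonicalMap hr0 hx⟩,
    fun p hp => (contDiffAt_canonicalMap hr0 hp.1 hp.2).contDiffWithinAt⟩, ?_, ?_, ?_, ?_⟩
  · intro x hx α hα
    rw [heq hα (hA hx), heq hx (hA hα), canonicalMap_antisymm]
  · intro x hx
    obtain ⟨d, hdx, hdα, hd⟩ := exists_hasDerivAt_canonicalMap_self hr0 hx
    exact ⟨d, hdx.congr_of_eventuallyEq ((heq hx).eventuallyEq_of_mem
      ((isOpen_annulus r 1).mem_nhds (hA hx))),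
      hdα.congr_of_eventuallyEq (eventually_of_mem (Ioo_mem_nhds hx.1 hx.2)
        fun α hα => heq hα (hA hx)), neg_lt_neg hd⟩
  · intro x hx
    obtain ⟨m, hm, hmeq⟩ := exists_slit_canonicalMap_eq hr0 hx
    rw [(hf x hx).slit_eq hr0 hx, hmeq, circularArc_inter_im_eq_zero (hr0.trans hx.1) hm]
  · obtain ⟨e, he, hsmooth⟩ := exists_contDiffOn_isArcEndpoint_iff hr0
    exact ⟨e, fun x hx w => (hf x hx).slit_eq hr0 hx ▸ he x hx w, hsmooth⟩
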